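/- Let $\mathsf h$ be a complex separable Hilbert space and let $\mathcal T=(\mathcal T_t)_{t\ge 0}$ be a uniformly continuous quantum Markov semigroup on $\mathcal B(\mathsf h)$, i.e. a semigroup of completely positive, identity preserving, normal maps with $\lim_{t\to0^+}\|\mathcal T_t-\mathrm{id}\|=0$. Its decoherence-free subalgebra is $$\mathcal N(\mathcal T)=\{x\in\mathcal B(\mathsf h) : \mathcal T_t(x^*x)=\mathcal T_t(x)^*\mathcal T_t(x),\ \mathcal T_t(xx^*)=\mathcal T_t(x)\mathcal T_t(x)^*\ \ \forall t\ge0\}.$$ Normal states are identified with their densities: positive trace class operators $\sigma$ with $\operatorname{tr}\sigma=1$; $\sigma$ is invariant if $\operatorname{tr}(\sigma\mathcal T_t(x))=\operatorname{tr}(\sigma x)$ for all $t\ge 0$, $x\in\mathcal B(\mathsf h)$, and faithful if $x\ge0$ and $\operatorname{tr}(\sigma x)=0$ imply $x=0$. Assume that $\mathcal T$ has a faithful normal invariant state. Then $\mathcal N(\mathcal T)$ is a direct sum of factors: there is a countable family $(p_i)_{i\in I}$ of mutually orthogonal projections, minimal in the center of $\mathcal N(\mathcal T)$ and with $\sum_i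 p_i=\mathbb 1$ strongly, such that $\mathcal N(\mathcal T)=\bigoplus_i p_i\mathcal N(\mathcal T)p_i$ and every $p_i\mathcal N(\mathcal T)p_i$ is a factor. Moreover, for every such family $(p_i)_{i\in I}$: 1. $\mathcal T_t$ maps $p_i\mathcal B(\mathsf h)p_i\cong\mathcal B(p_i\mathsf h)$ into itself for all $i$ and $t\ge 0$; let $\mathcal T^i$ denote the restriction of $\mathcal T$ to this algebra. 2. If $\sigma$ is a normal invariant state of $\mathcal T$, then $p_i\sigma p_j=0$ whenever $i\ne j$, and $\sigma=\sum_{i\in I}p_i\sigma p_i$ with convergence in trace norm; every $p_i\sigma p_i$, viewed on $p_i\mathsf h$, is a (possibly zero) positive trace class operator defining a normal invariant functional for $\mathcal T^i$. 3. If moreover $\sigma$ is faithful, then for every $i$ one has $\operatorname{tr}(p_i\sigma p_i)\neq0$ and $$\sigma_i:=\frac{p_i\sigma p_i}{\operatorname{tr}(p_i\sigma p_i)}$$ is a faithful normal state on $\mathcal B(p_i\mathsf h)$. -/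

import Mathlib

open scoped NNReal ENNReal Topology CStarAlgebra
open Filter

noncomputable section

namespace QMS

/-! ### Trace, trace norm and normal states on `B(H)` -/

section Trace

variable (H : Type*) [NormedAddCommGroup H] [InnerProductSpace ℂ H] [CompleteSpace H]

/-- The index set of a fixed orthonormal basis of `H`. -/
def basisIndex : Set H := (exists_hilbertBasis ℂ H).choose

/-- A fixed orthonormal (Hilbert) basis of `H`. -/
def basis : HilbertBasis (basisIndex H) ℂ H := (exists_hilbertBasis ℂ H).choose_spec.choose

variable {H}

/-- The trace norm `‖x‖₁ = ∑ ⟨e, |x| e⟩`, summed over an orthonormal basis, where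
`|x| = √(x* x)`; it is `∞` if `x` is not trace class. -/
def traceNorm (x : H →L[ℂ] H) : ℝ≥0∞ :=
  ∑' e : basisIndex H, ENNReal.ofReal (inner ℂ (basis H e) (CFC.abs x (basis H e))).re

/-- Trace class operators. -/
def IsTraceClass (x : H →L[ℂ] H) : Prop := traceNorm x ≠ ∞

/-- The trace `tr x = ∑ ⟨e, x e⟩` (used for trace class operators only). -/
def trace (x : H →L[ℂ] H) : ℂ := ∑' e : basisIndex H, inner ℂ (basis H e) (x (basis H e))

/-- `σ` is a positive trace class operator, that is, the density of the normal positive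
functional `x ↦ tr (σ x)` on `B(H)`. -/
def IsNormalPositive (σ : H →L[ℂ] H) : Prop := 0 ≤ σ ∧ IsTraceClass σ

/-- `σ` is a density operator, that is, the density of the normal state `x ↦ tr (σ x)`. -/
def IsNormalState (σ : H →L[ℂ] H) : Prop := IsNormalPositive σ ∧ trace σ = 1

/-- The functional `x ↦ tr (σ x)` is faithful: it vanishes on no nonzero positive operator. -/
def IsFaithful (σ : H →L[ℂ] H) : Prop := ∀ x : H →L[ℂ] H, 0 ≤ x → trace (σ * x) = 0 → x = 0

end Trace

/-! ### Quantum Markov semigroups -/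

section Semigroup

variable {H : Type*} [NormedAddCommGroup H] [InnerProductSpace ℂ H] [CompleteSpace H]

/-- Complete positivity of a bounded linear map of `B(H)`. -/
def IsCompletelyPositive (Φ : (H →L[ℂ] H) →L[ℂ] (H →L[ℂ] H)) : Prop :=
  ∃ Ψ : (H →L[ℂ] H) →CP (H →L[ℂ] H), ∀ x, Ψ x = Φ x

/-- Normality of a positive linear map `Φ` of `B(H)`: composing a normal positive functional with
`Φ` gives a normal positive functional. Since the normal positive functionals span the predual of
`B(H)`, this is the weak-* continuity of `Φ`. -/
def IsNormalMap (Φ : (H →L[ℂ] H) →L[ℂ] (H →L[ℂ] H)) : Prop :=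
  ∀ ρ : H →L[ℂ] H, IsNormalPositive ρ →
    ∃ ρ' : H →L[ℂ] H, IsNormalPositive ρ' ∧ ∀ x, trace (ρ * Φ x) = trace (ρ' * x)

/-- `T` is a uniformly continuous quantum Markov semigroup on `B(H)`: a norm continuous semigroup
of completely positive, identity preserving, normal maps. -/
structure IsUniformlyContinuousQMS (T : ℝ≥0 → (H →L[ℂ] H) →L[ℂ] (H →L[ℂ] H)) : Prop where
  map_zero : T 0 = ContinuousLinearMap.id ℂ (H →L[ℂ] H)
  map_add : ∀ s t x, T (s + t) x = T s (T t x)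
  completelyPositive : ∀ t, IsCompletelyPositive (T t)
  map_one : ∀ t, T t 1 = 1
  normal : ∀ t, IsNormalMap (T t)
  uniformlyContinuous :
    Tendsto (fun t => ‖T t - ContinuousLinearMap.id ℂ (H →L[ℂ] H)‖) (𝓝[>] 0) (𝓝 0)

/-- The functional `x ↦ tr (σ x)` is invariant under `T`. -/
def IsInvariant (T : ℝ≥0 → (H →L[ℂ] H) →L[ℂ] (H →L[ℂ] H)) (σ : H →L[ℂ] H) : Prop :=
  ∀ t x, trace (σ * T t x) = trace (σ * x)

/-- The decoherence-free subalgebra `N(T)`. -/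
def decoherenceFree (T : ℝ≥0 → (H →L[ℂ] H) →L[ℂ] (H →L[ℂ] H)) : Set (H →L[ℂ] H) :=
  {x | ∀ t, T t (star x * x) = star (T t x) * T t x ∧ T t (x * star x) = T t x * star (T t x)}

end Semigroup

/-! ### Central decomposition into factors -/

section Decomposition

variable {H : Type*} [NormedAddCommGroup H] [InnerProductSpace ℂ H] [CompleteSpace H]

/-- The center of an algebra `M ⊆ B(H)`. -/
def centerOf (M : Set (H →L[ℂ] H)) : Set (H →L[ℂ] H) := {x ∈ M | ∀ y ∈ M, x * y = y * x}

/-- The block `p M p`. -/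
def blockOf (M : Set (H →L[ℂ] H)) (p : H →L[ℂ] H) : Set (H →L[ℂ] H) :=
  (fun x => p * x * p) '' M

/-- `p` is a minimal projection of the center of `M`. -/
structure IsMinimalCentralProjection (M : Set (H →L[ℂ] H)) (p : H →L[ℂ] H) : Prop where
  isStarProjection : IsStarProjection p
  mem_center : p ∈ centerOf M
  ne_zero : p ≠ 0
  minimal : ∀ q ∈ centerOf M, IsStarProjection q → q ≤ p → q = 0 ∨ q = p

/-- `M = ⨁ i, p i M p i`, where the `p i` are mutually orthogonal projections summing (strongly)
to the identity, minimal in the center of `M`, and every `p i M p i` is a factor. -/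
structure IsFactorDecomposition {ι : Type*} (M : Set (H →L[ℂ] H)) (p : ι → H →L[ℂ] H) :
    Prop where
  minimal : ∀ i, IsMinimalCentralProjection M (p i)
  orthogonal : ∀ i j, i ≠ j → p i * p j = 0
  hasSum : ∀ v, HasSum (fun i => p i v) v
  mem_iff : ∀ x, x ∈ M ↔
    (∀ i j, i ≠ j → p i * x * p j = 0) ∧ ∀ i, p i * x * p i ∈ blockOf M (p i)
  factor : ∀ i, centerOf (blockOf M (p i)) = Set.range fun c : ℂ => c • p i

end Decomposition

/-! ### Reduction by a projection -/

section Reduction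

variable {H : Type*} [NormedAddCommGroup H] [InnerProductSpace ℂ H] [CompleteSpace H]

/-- The Hilbert space `p H = {v | p v = v}` of a projection `p`, as a closed subspace of `H`. -/
abbrev rangeSpace (p : H →L[ℂ] H) : Submodule ℂ H := (1 - p).ker

/-- The compression `x ↦ p x|_{p H}` from `B(H)` to `B(p H)`; it depends on `p x p` only and
restricts to the identification of `p B(H) p` with `B(p H)`. -/
def corner (p : H →L[ℂ] H) :
    (H →L[ℂ] H) →L[ℂ] (rangeSpace p →L[ℂ] rangeSpace p) :=
  (ContinuousLinearMap.compL ℂ (rangeSpace p) H (rangeSpace p)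
      (rangeSpace p).orthogonalProjectionOnto) ∘L
    (ContinuousLinearMap.compL ℂ (rangeSpace p) H H).flip (rangeSpace p).subtypeL

/-- The embedding of `B(p H)` into `B(H)`, with image `p B(H) p`: the operator is extended by `0`
on the orthogonal complement of `p H`. -/
def inflate (p : H →L[ℂ] H) :
    (rangeSpace p →L[ℂ] rangeSpace p) →L[ℂ] (H →L[ℂ] H) :=
  (ContinuousLinearMap.compL ℂ H (rangeSpace p) H (rangeSpace p).subtypeL) ∘L
    (ContinuousLinearMap.compL ℂ H (rangeSpace p) (rangeSpace p)).flip
      (rangeSpace p).orthogonalProjectionOnto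

/-- The restriction of `T` to `B(p H) ≃ p B(H) p`. -/
def restrict (T : ℝ≥0 → (H →L[ℂ] H) →L[ℂ] (H →L[ℂ] H)) (p : H →L[ℂ] H) :
    ℝ≥0 → (rangeSpace p →L[ℂ] rangeSpace p) →L[ℂ] (rangeSpace p →L[ℂ] rangeSpace p) :=
  fun t => corner p ∘L T t ∘L inflate p

end Reduction

end QMS

end

/-!
The decoherence-free subalgebra `N(T)` is the common multiplicative domain of the maps `T t`
(Kadison–Schwarz, `IsUniformlyContinuousQMS.mem_decoherenceFree_iff`). It is a `*`-algebra, and by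
normality of the `T t` it is closed under bounded weak limits. Everything rests on two facts about
its center `Z`.

*The semigroup fixes `Z` pointwise* (`IsUniformlyContinuousQMS.map_center`). If `u ∈ Z` is unitary
and `‖T t - id‖ = δ < 1`, then `w = T t u * u*` satisfies `‖w ^ n - 1‖ ≤ δ` for all `n`, which
forces `w = 1`. Unitaries span `Z`, and small times generate all times. Since elements of `N(T)`
factor out of `T t`, the corners `p B(H) p` for projections `p ∈ Z` are invariant.

*Normal invariant states commute with `Z`* (`IsUniformlyContinuousQMS.commute_of_mem_center`). A
weak limit point `E` of the ergodic means of `x` is a fixed point of the semigroup, and the faithful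
invariant state turns Schwarz inequalities at fixed points into equalities, so `E ∈ N(T)`. As
elements `z ∈ Z` factor out of the means, `tr (σ z x) = tr (σ z E) = tr (σ E z) = tr (σ x z)`. So
invariant states are block diagonal.

In particular `Z` commutes with the faithful density `ρ`. Its spectral subspaces
`range (ρ - ε)⁺` are finite-dimensional because `ρ` has finite trace, they are invariant under `Z`,
and every nonzero projection of `Z` acts nontrivially on one of them. Finite-dimensional arguments
there yield a minimal projection below each projection of `Z` (`exists_pure_vector`,
`IsUniformlyContinuousQMS.exists_minimal_of_pure`), so the minimal ones sum to the identity, and an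
eigenvalue for each central element (`IsUniformlyContinuousQMS.exists_eq_smul_of_minimal`), so the
blocks are factors.

Traces are computed through Hilbert–Schmidt factorizations `σ = A† A` and the formula
`tr (A† A x) = ∑ ⟨A† f, x A† f⟩`, valid for every orthonormal basis `f`
(`IsHilbertSchmidt.hasSum_trace`).
-/

set_option linter.unusedSectionVars false

namespace QMS

open ContinuousLinearMap
open scoped InnerProduct ComplexStarModule

/-! ### Hilbert–Schmidt operators and the trace -/

section HilbertSchmidt

variable {H K L : Type*} [NormedAddCommGroup H] [InnerProductSpace ℂ H] [CompleteSpace H]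
  [NormedAddCommGroup K] [InnerProductSpace ℂ K] [CompleteSpace K]
  [NormedAddCommGroup L] [InnerProductSpace ℂ L] [CompleteSpace L]

/-- `A` is a Hilbert–Schmidt operator; the sum runs over the basis that defines the trace. -/
def IsHilbertSchmidt (A : H →L[ℂ] L) : Prop := Summable fun e => ‖A (basis H e)‖ ^ 2

theorem tsum_ofReal_norm_inner_sq {ι : Type*} (b : HilbertBasis ι ℂ H) (v : H) :
    ∑' i, ENNReal.ofReal (‖inner ℂ (b i) v‖ ^ 2) = ENNReal.ofReal (‖v‖ ^ 2) := by
  have h := (b.hasSum_inner_mul_inner v v).mapL Complex.reCLM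
  have h2 : HasSum (fun i => ‖inner ℂ (b i) v‖ ^ 2) (‖v‖ ^ 2) := by
    convert h using 1
    · ext i
      rw [← inner_conj_symm v (b i), Complex.conj_mul']
      norm_cast
    · rw [inner_self_eq_norm_sq_to_K]; norm_cast
  rw [← h2.tsum_eq, ENNReal.ofReal_tsum_of_nonneg (fun _ => by positivity) h2.summable]

/-- Parseval's identity in both variables: the Hilbert–Schmidt norms of an operator and of its
adjoint, computed in arbitrary orthonormal bases, agree. -/
theorem tsum_norm_sq_eq_tsum_adjoint {ι κ : Type*} (b : HilbertBasis ι ℂ H) (c : HilbertBasis κ ℂ L)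
    (A : H →L[ℂ] L) :
    ∑' i, ENNReal.ofReal (‖A (b i)‖ ^ 2) = ∑' j, ENNReal.ofReal (‖adjoint A (c j)‖ ^ 2) := by
  simp_rw [← tsum_ofReal_norm_inner_sq c, ← tsum_ofReal_norm_inner_sq b]
  rw [ENNReal.tsum_comm]
  refine tsum_congr fun j => tsum_congr fun i => ?_
  rw [adjoint_inner_right, norm_inner_symm]

theorem summable_norm_sq_iff {ι : Type*} (f : ι → L) :
    Summable (fun i => ‖f i‖ ^ 2) ↔ ∑' i, ENNReal.ofReal (‖f i‖ ^ 2) ≠ ∞ := by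
  constructor
  · intro h
    rw [← ENNReal.ofReal_tsum_of_nonneg (fun _ => by positivity) h]
    exact ENNReal.ofReal_ne_top
  · intro h
    have := ENNReal.summable_toReal h
    refine this.congr fun i => ENNReal.toReal_ofReal (by positivity)

theorem IsHilbertSchmidt.summable_adjoint {A : H →L[ℂ] L} (hA : IsHilbertSchmidt A) {κ : Type*}
    (c : HilbertBasis κ ℂ L) : Summable fun j => ‖adjoint A (c j)‖ ^ 2 := by
  rw [summable_norm_sq_iff, ← tsum_norm_sq_eq_tsum_adjoint (basis H)]
  exact (summable_norm_sq_iff _).1 hA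

theorem IsHilbertSchmidt.of_summable_adjoint {A : H →L[ℂ] L} {κ : Type*}
    (c : HilbertBasis κ ℂ L) (h : Summable fun j => ‖adjoint A (c j)‖ ^ 2) :
    IsHilbertSchmidt A := by
  rw [IsHilbertSchmidt, summable_norm_sq_iff, tsum_norm_sq_eq_tsum_adjoint (basis H) c]
  exact (summable_norm_sq_iff _).1 h

theorem IsHilbertSchmidt.comp {A : H →L[ℂ] L} (hA : IsHilbertSchmidt A) (B : K →L[ℂ] H) :
    IsHilbertSchmidt (A ∘L B) := by
  refine .of_summable_adjoint (basis L) ?_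
  refine Summable.of_nonneg_of_le (fun _ => by positivity) (fun j => ?_)
    ((hA.summable_adjoint (basis L)).mul_left (‖B†‖ ^ 2))
  rw [adjoint_comp, ← mul_pow]
  exact pow_le_pow_left₀ (norm_nonneg _) (le_opNorm (adjoint B) _) 2

/-- `tr (A† A x) = ∑ ⟨A† f, x A† f⟩` over *any* orthonormal basis `f` of the target of a
Hilbert–Schmidt operator `A`. This is the cyclicity of the trace that carries all later
computations: continuity, independence of the basis, and reduction to a corner. -/
theorem IsHilbertSchmidt.hasSum_trace {A : H →L[ℂ] L} (hA : IsHilbertSchmidt A) {κ : Type*}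
    (c : HilbertBasis κ ℂ L) (x : H →L[ℂ] H) :
    HasSum (fun j => inner ℂ (adjoint A (c j)) (x (adjoint A (c j)))) (trace ((A† ∘L A) * x)) := by
  classical
  -- both sides are iterated sums of the same absolutely summable double series `F`
  set F : basisIndex H × κ → ℂ := fun q =>
    inner ℂ (A (basis H q.1)) (c q.2) * inner ℂ (c q.2) ((A ∘L x) (basis H q.1)) with hF
  have hsq : ∀ B : H →L[ℂ] L, IsHilbertSchmidt B →
      Summable fun q : basisIndex H × κ => ‖inner ℂ (c q.2) (B (basis H q.1))‖ ^ 2 := by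
    intro B hB
    rw [summable_norm_sq_iff,
      ENNReal.tsum_prod (f := fun e j => ENNReal.ofReal (‖inner ℂ (c j) (B (basis H e))‖ ^ 2))]
    simp_rw [tsum_ofReal_norm_inner_sq c]
    exact (summable_norm_sq_iff _).1 hB
  have hsum : Summable F := by
    refine Summable.of_norm_bounded ((hsq A hA).add (hsq _ (hA.comp x))) fun q => ?_
    rw [hF, norm_mul, norm_inner_symm]
    nlinarith [sq_nonneg (‖inner ℂ (c q.2) (A (basis H q.1))‖ -
      ‖inner ℂ (c q.2) ((A ∘L x) (basis H q.1))‖),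
      sq_nonneg ‖inner ℂ (c q.2) (A (basis H q.1))‖,
      sq_nonneg ‖inner ℂ (c q.2) ((A ∘L x) (basis H q.1))‖]
  have h1 : ∀ e, HasSum (fun j => F (e, j))
      (inner ℂ (basis H e) (((A† ∘L A) * x) (basis H e))) := fun e => by
    have := c.hasSum_inner_mul_inner (A (basis H e)) ((A ∘L x) (basis H e))
    rwa [← show inner ℂ (basis H e) (((A† ∘L A) * x) (basis H e)) =
      inner ℂ (A (basis H e)) ((A ∘L x) (basis H e)) from adjoint_inner_right A _ _] at this
  have h2 : ∀ j, HasSum (fun e => F (e, j))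
      (inner ℂ (adjoint A (c j)) (x (adjoint A (c j)))) := fun j => by
    have := (basis H).hasSum_inner_mul_inner (adjoint x (adjoint A (c j))) (adjoint A (c j))
    rw [adjoint_inner_left] at this
    refine this.congr_fun fun e => ?_
    simp only [hF, adjoint_inner_left, adjoint_inner_right, coe_comp, Function.comp]
    ring
  have h3 := hsum.hasSum.prod_fiberwise h1
  have h4 := ((Equiv.prodComm _ _).hasSum_iff.2 hsum.hasSum).prod_fiberwise
    (f := F ∘ Equiv.prodComm _ _) (fun j => h2 j)
  rw [trace, h3.tsum_eq]
  exact h4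

end HilbertSchmidt

/-! ### Normal functionals and bounded weak limits -/

section NormalFunctionals

variable {H K : Type*} [NormedAddCommGroup H] [InnerProductSpace ℂ H] [CompleteSpace H]
  [NormedAddCommGroup K] [InnerProductSpace ℂ K] [CompleteSpace K]

theorem nonneg_adjoint_comp_self (A : H →L[ℂ] K) : (0 : H →L[ℂ] H) ≤ A† ∘L A :=
  (nonneg_iff_isPositive _).2 (isPositive_adjoint_comp_self A)

theorem traceNorm_adjoint_comp_self (A : H →L[ℂ] K) :
    traceNorm (A† ∘L A) = ∑' e, ENNReal.ofReal (‖A (basis H e)‖ ^ 2) := by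
  rw [traceNorm, CFC.abs_of_nonneg _ (nonneg_adjoint_comp_self A)]
  refine tsum_congr fun e => ?_
  rw [coe_comp, Function.comp, adjoint_inner_right, inner_self_eq_norm_sq_to_K]
  norm_cast

theorem IsHilbertSchmidt.isNormalPositive {A : H →L[ℂ] K} (hA : IsHilbertSchmidt A) :
    IsNormalPositive (A† ∘L A) := by
  refine ⟨nonneg_adjoint_comp_self A, ?_⟩
  rw [IsTraceClass, traceNorm_adjoint_comp_self]
  exact (summable_norm_sq_iff _).1 hA

theorem IsNormalPositive.exists_isHilbertSchmidt {σ : H →L[ℂ] H} (hσ : IsNormalPositive σ) :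
    ∃ A : H →L[ℂ] H, IsHilbertSchmidt A ∧ A† ∘L A = σ := by
  have h : (CFC.sqrt σ)† ∘L CFC.sqrt σ = σ := by
    have h1 : (CFC.sqrt σ)† = CFC.sqrt σ := (CFC.sqrt_nonneg σ).isSelfAdjoint
    rw [h1]
    exact CFC.sqrt_mul_sqrt_self σ hσ.1
  refine ⟨CFC.sqrt σ, ?_, h⟩
  rw [IsHilbertSchmidt, summable_norm_sq_iff, ← traceNorm_adjoint_comp_self, h]
  exact hσ.2

section Linear

variable {σ : H →L[ℂ] H} (hσ : IsNormalPositive σ)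
include hσ

theorem IsNormalPositive.trace_mul_add (x y : H →L[ℂ] H) :
    trace (σ * (x + y)) = trace (σ * x) + trace (σ * y) := by
  obtain ⟨A, hA, rfl⟩ := hσ.exists_isHilbertSchmidt
  refine (hA.hasSum_trace (basis H) (x + y)).unique ?_
  convert (hA.hasSum_trace (basis H) x).add (hA.hasSum_trace (basis H) y) using 2
  simp

theorem IsNormalPositive.trace_mul_smul (c : ℂ) (x : H →L[ℂ] H) :
    trace (σ * (c • x)) = c * trace (σ * x) := by
  obtain ⟨A, hA, rfl⟩ := hσ.exists_isHilbertSchmidt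
  refine (hA.hasSum_trace (basis H) (c • x)).unique ?_
  refine ((hA.hasSum_trace (basis H) x).mul_left c).congr_fun fun e => ?_
  rw [smul_apply, inner_smul_right]

theorem IsNormalPositive.trace_mul_sub (x y : H →L[ℂ] H) :
    trace (σ * (x - y)) = trace (σ * x) - trace (σ * y) := by
  rw [eq_sub_iff_add_eq, ← hσ.trace_mul_add, sub_add_cancel]

theorem IsNormalPositive.trace_mul_sum {ι : Type*} (s : Finset ι) (x : ι → H →L[ℂ] H) :
    trace (σ * ∑ i ∈ s, x i) = ∑ i ∈ s, trace (σ * x i) := by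
  classical
  induction s using Finset.induction_on with
  | empty => simpa using hσ.trace_mul_smul 0 0
  | insert a s ha ih => rw [Finset.sum_insert ha, Finset.sum_insert ha, hσ.trace_mul_add, ih]

theorem IsNormalPositive.conj (B : K →L[ℂ] H) : IsNormalPositive (B† ∘L σ ∘L B) := by
  obtain ⟨A, hA, rfl⟩ := hσ.exists_isHilbertSchmidt
  have := (hA.comp B).isNormalPositive
  rwa [adjoint_comp] at this

/-- The functional with density `B† σ B` is the pullback of that with density `σ` along
`y ↦ B y B†`; here `B` may map from a different Hilbert space. -/
theorem IsNormalPositive.trace_conj_mul (B : K →L[ℂ] H) (y : K →L[ℂ] K) :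
    trace ((B† ∘L σ ∘L B) * y) = trace (σ * (B ∘L y ∘L B†)) := by
  obtain ⟨A, hA, rfl⟩ := hσ.exists_isHilbertSchmidt
  have h1 := (hA.comp B).hasSum_trace (basis H) y
  have h2 := hA.hasSum_trace (basis H) (B ∘L y ∘L B†)
  rw [adjoint_comp] at h1
  refine h1.unique (h2.congr_fun fun e => ?_)
  simp only [coe_comp, Function.comp]
  exact adjoint_inner_left B (y (adjoint B (adjoint A (basis H e)))) (adjoint A (basis H e))

theorem IsNormalPositive.trace_mul_rankOne (a b : H) :
    trace (σ * InnerProductSpace.rankOne ℂ a b) = inner ℂ b (σ a) := by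
  obtain ⟨A, hA, rfl⟩ := hσ.exists_isHilbertSchmidt
  refine (hA.hasSum_trace (basis H) _).unique ?_
  have := (basis H).hasSum_inner_mul_inner (A b) (A a)
  rw [← show inner ℂ b ((A† ∘L A) a) = inner ℂ (A b) (A a) from adjoint_inner_right A _ _] at this
  refine this.congr_fun fun e => ?_
  rw [InnerProductSpace.rankOne_apply, inner_smul_right, adjoint_inner_right, adjoint_inner_left]

theorem IsNormalPositive.traceNorm_eq : traceNorm σ = ENNReal.ofReal (trace σ).re := by
  obtain ⟨A, hA, rfl⟩ := hσ.exists_isHilbertSchmidt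
  have h := (hA.hasSum_trace (basis H) 1).mapL Complex.reCLM
  rw [mul_one] at h
  have h' : HasSum (fun e => ‖adjoint A (basis H e)‖ ^ 2) (trace (A† ∘L A)).re := by
    refine h.congr_fun fun e => ?_
    change _ = (inner ℂ (adjoint A (basis H e)) (adjoint A (basis H e))).re
    rw [inner_self_eq_norm_sq_to_K]; norm_cast
  rw [traceNorm_adjoint_comp_self, tsum_norm_sq_eq_tsum_adjoint _ (basis H), ← h'.tsum_eq,
    ENNReal.ofReal_tsum_of_nonneg (fun _ => by positivity) h'.summable]

open scoped ComplexOrder in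
theorem IsNormalPositive.trace_nonneg : 0 ≤ trace σ := by
  obtain ⟨A, hA, rfl⟩ := hσ.exists_isHilbertSchmidt
  have h := hA.hasSum_trace (basis H) 1
  rw [mul_one] at h
  refine h.nonneg fun e => ?_
  change 0 ≤ inner ℂ (adjoint A (basis H e)) (adjoint A (basis H e))
  rw [inner_self_eq_norm_sq_to_K]
  exact pow_nonneg (RCLike.ofReal_nonneg.2 (norm_nonneg _)) 2

end Linear

theorem isNormalPositive_rankOne (v : H) :
    IsNormalPositive (InnerProductSpace.rankOne ℂ v v) := by
  set A : H →L[ℂ] ℂ := innerSL ℂ v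
  have hA : IsHilbertSchmidt A := ((basis H).summable_inner_mul_inner v v).norm.congr fun e => by
    rw [norm_mul, norm_inner_symm, ← sq, innerSL_apply_apply, norm_inner_symm]
  rw [InnerProductSpace.rankOne_def', ← adjoint_innerSL_apply]
  exact hA.isNormalPositive

theorem trace_rankOne_mul (v : H) (y : H →L[ℂ] H) :
    trace (InnerProductSpace.rankOne ℂ v v * y) = inner ℂ v (y v) := by
  rw [trace, ← adjoint_inner_left, ← (basis H).tsum_inner_mul_inner]
  refine tsum_congr fun e => ?_
  change inner ℂ _ (InnerProductSpace.rankOne ℂ v v (y (basis H e))) = _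
  rw [InnerProductSpace.rankOne_apply, inner_smul_right, adjoint_inner_left]

end NormalFunctionals

section WeakLimits

variable {H : Type*} [NormedAddCommGroup H] [InnerProductSpace ℂ H] [CompleteSpace H]

/-- `X` is bounded and converges to `x` along `l` in the weak operator topology. -/
structure BoundedWeakTendsto {α : Type*} (X : α → H →L[ℂ] H) (l : Filter α) (x : H →L[ℂ] H) :
    Prop where
  bounded : ∃ C, ∀ a, ‖X a‖ ≤ C
  tendsto : ∀ u v, Tendsto (fun a => inner ℂ u (X a v)) l (𝓝 (inner ℂ u (x v)))

variable {α : Type*} {X : α → H →L[ℂ] H} {l : Filter α} {x : H →L[ℂ] H}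

theorem BoundedWeakTendsto.mul_left (h : BoundedWeakTendsto X l x) (y : H →L[ℂ] H) :
    BoundedWeakTendsto (fun a => y * X a) l (y * x) := by
  obtain ⟨C, hC⟩ := h.bounded
  refine ⟨⟨‖y‖ * C, fun a => (norm_mul_le _ _).trans (by gcongr; exact hC a)⟩, fun u v => ?_⟩
  simpa [adjoint_inner_left] using h.tendsto (adjoint y u) v

theorem BoundedWeakTendsto.mul_right (h : BoundedWeakTendsto X l x) (y : H →L[ℂ] H) :
    BoundedWeakTendsto (fun a => X a * y) l (x * y) := by
  obtain ⟨C, hC⟩ := h.bounded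
  refine ⟨⟨C * ‖y‖, fun a => (norm_mul_le _ _).trans (by gcongr; exact hC a)⟩, fun u v => ?_⟩
  exact h.tendsto u (y v)

theorem BoundedWeakTendsto.unique [l.NeBot] {y : H →L[ℂ] H} (hx : BoundedWeakTendsto X l x)
    (hy : BoundedWeakTendsto X l y) : x = y := by
  ext v
  exact ext_inner_left ℂ fun u => tendsto_nhds_unique (hx.tendsto u v) (hy.tendsto u v)

theorem BoundedWeakTendsto.of_tendsto (hC : ∃ C, ∀ a, ‖X a‖ ≤ C)
    (h : ∀ v, Tendsto (fun a => X a v) l (𝓝 (x v))) : BoundedWeakTendsto X l x :=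
  ⟨hC, fun _ v => tendsto_const_nhds.inner (h v)⟩

/-- Polarization: the diagonal matrix elements decide about weak convergence. -/
theorem BoundedWeakTendsto.of_diagonal (hC : ∃ C, ∀ a, ‖X a‖ ≤ C)
    (h : ∀ v, Tendsto (fun a => inner ℂ v (X a v)) l (𝓝 (inner ℂ v (x v)))) :
    BoundedWeakTendsto X l x := by
  have h' : ∀ v, Tendsto (fun a => inner ℂ (X a v) v) l (𝓝 (inner ℂ (x v) v)) := fun v => by
    simpa [Function.comp_def] using (Complex.continuous_conj.tendsto _).comp (h v)
  refine ⟨hC, fun u v => ?_⟩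
  have key : Tendsto (fun a => inner ℂ (X a v) u) l (𝓝 (inner ℂ (x v) u)) := by
    have e1 : ∀ y : H →L[ℂ] H, inner ℂ (y v) u =
        (inner ℂ (y (u + v)) (u + v) - inner ℂ (y (u - v)) (u - v) +
          Complex.I * inner ℂ (y (u + Complex.I • v)) (u + Complex.I • v) -
          Complex.I * inner ℂ (y (u - Complex.I • v)) (u - Complex.I • v)) / 4 :=
      fun y => inner_map_polarization (y : H →ₗ[ℂ] H) u v
    simp_rw [e1]
    exact ((((h' _).sub (h' _)).add ((h' _).const_mul _)).sub ((h' _).const_mul _)).div_const _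
  simpa [Function.comp_def] using (Complex.continuous_conj.tendsto _).comp key

/-- Normal functionals are continuous for bounded weak limits. -/
theorem BoundedWeakTendsto.trace {σ : H →L[ℂ] H} (hσ : IsNormalPositive σ)
    (h : BoundedWeakTendsto X l x) :
    Tendsto (fun a => QMS.trace (σ * X a)) l (𝓝 (QMS.trace (σ * x))) := by
  obtain ⟨A, hA, rfl⟩ := hσ.exists_isHilbertSchmidt
  obtain ⟨C, hC⟩ := h.bounded
  simp_rw [← fun y => (hA.hasSum_trace (basis H) y).tsum_eq]
  refine tendsto_tsum_of_dominated_convergence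
    ((hA.summable_adjoint (basis H)).mul_left C) (fun e => h.tendsto _ _) ?_
  filter_upwards with a e
  calc _ ≤ ‖adjoint A (basis H e)‖ * ‖X a (adjoint A (basis H e))‖ := norm_inner_le_norm _ _
    _ ≤ ‖adjoint A (basis H e)‖ * (C * ‖adjoint A (basis H e)‖) := by
        gcongr; exact (le_opNorm _ _).trans (by gcongr; exact hC a)
    _ = _ := by ring

end WeakLimits

/-! ### The Kadison–Schwarz inequality and multiplicative domains -/

section Schwarz

variable {H : Type*} [NormedAddCommGroup H] [InnerProductSpace ℂ H] [CompleteSpace H]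

/-- A diagonal entry of a positive operator matrix is positive. -/
theorem cstarMatrix_diag_nonneg {A : Type*} [CStarAlgebra A] [PartialOrder A] [StarOrderedRing A]
    {M : CStarMatrix (Fin 2) (Fin 2) A} (hM : 0 ≤ M) (i : Fin 2) : 0 ≤ M i i := by
  rw [StarOrderedRing.nonneg_iff] at hM
  induction hM using AddSubmonoid.closure_induction with
  | mem x hx =>
    obtain ⟨C, rfl⟩ := hx
    change 0 ≤ (star C * C) i i
    rw [CStarMatrix.mul_apply]
    exact Finset.sum_nonneg fun j _ => by
      rw [CStarMatrix.star_apply]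
      exact star_mul_self_nonneg _
  | zero => exact le_rfl
  | add x y _ _ hx hy => exact add_nonneg hx hy

theorem IsCompletelyPositive.map_star {Φ : (H →L[ℂ] H) →L[ℂ] (H →L[ℂ] H)}
    (hΦ : IsCompletelyPositive Φ) (x : H →L[ℂ] H) : Φ (star x) = star (Φ x) := by
  obtain ⟨Ψ, hΨ⟩ := hΦ
  have hsa : ∀ a : H →L[ℂ] H, IsSelfAdjoint a → star (Φ a) = Φ a := fun a ha => by
    rw [← hΨ]; exact ha.map' Ψ
  conv_lhs => rw [← realPart_add_I_smul_imaginaryPart x]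
  conv_rhs => rw [← realPart_add_I_smul_imaginaryPart x]
  simp only [star_add, star_smul, map_add, map_smul, hsa _ (ℜ x).2, hsa _ (ℑ x).2,
    (ℜ x).2.star_eq, (ℑ x).2.star_eq]

/-- The Kadison–Schwarz inequality, from positivity of the `2 × 2` matrix with rows
`x* x, x*` and `x, 1`. -/
theorem IsCompletelyPositive.star_mul_le {Φ : (H →L[ℂ] H) →L[ℂ] (H →L[ℂ] H)}
    (hΦ : IsCompletelyPositive Φ) (h1 : Φ 1 = 1) (x : H →L[ℂ] H) :
    star (Φ x) * Φ x ≤ Φ (star x * x) := by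
  have hstar := hΦ.map_star x
  obtain ⟨Ψ, hΨ⟩ := hΦ
  set N : CStarMatrix (Fin 2) (Fin 2) (H →L[ℂ] H) := CStarMatrix.ofMatrix !![x, 1; 0, 0]
  set B : CStarMatrix (Fin 2) (Fin 2) (H →L[ℂ] H) := CStarMatrix.ofMatrix !![1, 0; -Φ x, 0]
  have h2 := star_left_conjugate_nonneg
    (CompletelyPositiveMap.map_cstarMatrix_nonneg Ψ (star N * N) (star_mul_self_nonneg N)) B
  have h3 := cstarMatrix_diag_nonneg h2 0
  rw [← sub_nonneg]
  convert h3 using 1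
  simp [CStarMatrix.mul_apply, Fin.sum_univ_two, CStarMatrix.star_apply, N, B, hΨ, h1, hstar]
  exact sub_eq_add_neg _ _

/-- An affine function that is bounded below on the line is constant. -/
theorem eq_zero_of_forall_add_smul_nonneg {a b : ℝ} (h : ∀ t : ℝ, 0 ≤ a + t * b) : b = 0 := by
  by_contra hb
  have := h (-(a + 1) / b)
  rw [div_mul_cancel₀ _ hb] at this
  linarith

/-- The multiplicative domain: equality in the Schwarz inequality at `x` makes `Φ` multiplicative
for all products with right factor `x`. -/
theorem IsCompletelyPositive.map_mul_of_eq {Φ : (H →L[ℂ] H) →L[ℂ] (H →L[ℂ] H)}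
    (hΦ : IsCompletelyPositive Φ) (h1 : Φ 1 = 1) {x : H →L[ℂ] H}
    (hx : Φ (star x * x) = star (Φ x) * Φ x) (y : H →L[ℂ] H) : Φ (y * x) = Φ y * Φ x := by
  have key : ∀ (y : H →L[ℂ] H) (v : H),
      (inner ℂ ((Φ (star y * x) - star (Φ y) * Φ x) v) v).re = 0 := by
    intro y v
    -- the Schwarz defect at `y + t x` has no term of order `t ^ 2`, by `hx`
    have hpos : ∀ t : ℝ, 0 ≤ (inner ℂ ((Φ (star y * y) - star (Φ y) * Φ y) v) v).re +
        t * (2 * (inner ℂ ((Φ (star y * x) - star (Φ y) * Φ x) v) v).re) := by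
      intro t
      have h := hΦ.star_mul_le h1 (y + (t : ℂ) • x)
      rw [← sub_nonneg, nonneg_iff_isPositive] at h
      have h := h.re_inner_nonneg_left v
      have e1 : Φ (star (y + (t : ℂ) • x) * (y + (t : ℂ) • x)) -
          star (Φ (y + (t : ℂ) • x)) * Φ (y + (t : ℂ) • x) =
          (Φ (star y * y) - star (Φ y) * Φ y) +
          (t : ℂ) • ((Φ (star y * x) - star (Φ y) * Φ x) +
            star (Φ (star y * x) - star (Φ y) * Φ x)) := by
        have e2 : Φ (star x * y) = star (Φ (star y * x)) := by rw [← hΦ.map_star]; simp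
        simp only [star_add, star_smul, add_mul, mul_add, map_add, smul_mul_assoc, mul_smul_comm,
          map_smul, hx, star_sub, star_mul, star_star, e2, smul_add, smul_sub]
        simp
        abel
      rw [e1] at h
      have e3 : ∀ z : H →L[ℂ] H, (inner ℂ (star z v) v).re = (inner ℂ (z v) v).re := fun z => by
        rw [star_eq_adjoint, adjoint_inner_left, ← inner_conj_symm, Complex.conj_re]
      have e4 : ∀ z w : H →L[ℂ] H, (inner ℂ ((z + (t : ℂ) • (w + star w)) v) v).re =
          (inner ℂ (z v) v).re + t * (2 * (inner ℂ (w v) v).re) := fun z w => by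
        rw [add_apply, smul_apply, add_apply, inner_add_left, inner_smul_left, inner_add_left,
          Complex.conj_ofReal, Complex.add_re, Complex.re_ofReal_mul, Complex.add_re, e3]
        ring
      rw [← e4]
      exact h
    have := eq_zero_of_forall_add_smul_nonneg hpos
    linarith
  -- replacing `y` by `i y` turns the real part into the imaginary part
  have key2 : ∀ y : H →L[ℂ] H, Φ (star y * x) - star (Φ y) * Φ x = 0 := by
    intro y
    have h := (inner_map_self_eq_zero
      ((Φ (star y * x) - star (Φ y) * Φ x : H →L[ℂ] H) : H →ₗ[ℂ] H)).1 fun v => by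
        refine Complex.ext (key y v) ?_
        have := key (Complex.I • y) v
        simp only [star_smul, map_smul, smul_mul_assoc, ← smul_sub, smul_apply,
          inner_smul_left] at this
        simpa using this
    exact ContinuousLinearMap.ext fun v => LinearMap.congr_fun h v
  simpa [hΦ.map_star, sub_eq_zero] using key2 (star y)

theorem IsCompletelyPositive.norm_map_le {Φ : (H →L[ℂ] H) →L[ℂ] (H →L[ℂ] H)}
    (hΦ : IsCompletelyPositive Φ) (h1 : Φ 1 = 1) (x : H →L[ℂ] H) : ‖Φ x‖ ≤ ‖x‖ := by
  have hmono : ∀ a b, a ≤ b → Φ a ≤ Φ b := by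
    obtain ⟨Ψ, hΨ⟩ := hΦ
    intro a b hab
    rw [← hΨ, ← hΨ]
    exact OrderHomClass.mono Ψ hab
  have h2 : star (Φ x) * Φ x ≤ ((‖x‖ ^ 2 : ℝ) : ℂ) • (1 : H →L[ℂ] H) := by
    refine (hΦ.star_mul_le h1 x).trans ?_
    have h3 := CStarAlgebra.star_mul_le_algebraMap_norm_sq (a := x)
    rw [Algebra.algebraMap_eq_smul_one] at h3
    have h4 := hmono _ _ h3
    rw [RCLike.real_smul_eq_coe_smul (K := ℂ) (‖x‖ ^ 2), map_smul, h1] at h4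
    simpa using h4
  have h3 := CStarAlgebra.norm_le_norm_of_nonneg_of_le (star_mul_self_nonneg _) h2
  rw [CStarRing.norm_star_mul_self, norm_smul] at h3
  have h4 : ‖((‖x‖ ^ 2 : ℝ) : ℂ)‖ = ‖x‖ ^ 2 := by simp
  rw [h4] at h3
  refine le_of_pow_le_pow_left₀ two_ne_zero (norm_nonneg x) ?_
  nlinarith [sq_nonneg ‖x‖,
    show ‖(1 : H →L[ℂ] H)‖ ≤ 1 from norm_id_le]

end Schwarz

/-! ### The decoherence-free subalgebra and its center -/

section DecoherenceFree

variable {H : Type*} [NormedAddCommGroup H] [InnerProductSpace ℂ H] [CompleteSpace H]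

/-- Normal maps are continuous for bounded weak limits. -/
theorem BoundedWeakTendsto.map {α : Type*} {X : α → H →L[ℂ] H} {l : Filter α} {x : H →L[ℂ] H}
    (h : BoundedWeakTendsto X l x) {Φ : (H →L[ℂ] H) →L[ℂ] (H →L[ℂ] H)} (hΦ : IsNormalMap Φ) :
    BoundedWeakTendsto (fun a => Φ (X a)) l (Φ x) := by
  obtain ⟨C, hC⟩ := h.bounded
  refine .of_diagonal ⟨‖Φ‖ * C, fun a => (le_opNorm _ _).trans (by gcongr; exact hC a)⟩ fun v => ?_
  obtain ⟨ρ', hρ', heq⟩ := hΦ _ (isNormalPositive_rankOne v)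
  simp_rw [← trace_rankOne_mul, heq]
  exact h.trace hρ'

/-- An element all of whose powers stay within distance `δ < 1` of the identity is the
identity: `‖w ^ (2 n) - 1‖ ≥ (2 - δ) ‖w ^ n - 1‖`, so the distance grows geometrically. -/
theorem eq_one_of_norm_pow_sub_one_le {A : Type*} [NormedRing A] [NormedAlgebra ℂ A] {w : A}
    {δ : ℝ} (hδ : δ < 1)
    (h : ∀ n : ℕ, ‖w ^ n - 1‖ ≤ δ) : w = 1 := by
  have hstep : ∀ n : ℕ, (2 - δ) * ‖w ^ n - 1‖ ≤ ‖w ^ (n * 2) - 1‖ := by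
    intro n
    have e : (2 : ℂ) • (w ^ n - 1) = (w ^ (n * 2) - 1) - (w ^ n - 1) * (w ^ n - 1) := by
      rw [two_smul, pow_mul]
      noncomm_ring
    have h1 : 2 * ‖w ^ n - 1‖ ≤ ‖w ^ (n * 2) - 1‖ + ‖w ^ n - 1‖ * ‖w ^ n - 1‖ := by
      have : ‖(2 : ℂ) • (w ^ n - 1)‖ = 2 * ‖w ^ n - 1‖ := by rw [norm_smul]; norm_num
      rw [← this, e]
      exact (norm_sub_le _ _).trans (by gcongr; exact norm_mul_le _ _)
    nlinarith [h n, norm_nonneg (w ^ n - 1)]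
  have hgrow : ∀ k : ℕ, (2 - δ) ^ k * ‖w - 1‖ ≤ δ := by
    intro k
    refine le_trans ?_ (h (2 ^ k))
    induction k with
    | zero => simp
    | succ k ih =>
      rw [pow_succ', mul_assoc, pow_succ]
      refine le_trans ?_ (hstep _)
      have : 0 ≤ 2 - δ := by linarith
      gcongr
  by_contra hne
  have hpos : 0 < ‖w - 1‖ := norm_pos_iff.2 (sub_ne_zero.2 hne)
  obtain ⟨k, hk⟩ := pow_unbounded_of_one_lt (δ / ‖w - 1‖) (show 1 < 2 - δ by linarith)
  rw [div_lt_iff₀ hpos] at hk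
  exact absurd (hgrow k) (not_le.2 hk)

variable {T : ℝ≥0 → (H →L[ℂ] H) →L[ℂ] (H →L[ℂ] H)} (hT : IsUniformlyContinuousQMS T)
include hT

/-- `N(T)` is the common multiplicative domain of the maps `T t`. -/
theorem IsUniformlyContinuousQMS.mem_decoherenceFree_iff {x : H →L[ℂ] H} :
    x ∈ decoherenceFree T ↔
      ∀ t y, T t (y * x) = T t y * T t x ∧ T t (x * y) = T t x * T t y := by
  constructor
  · intro hx t y
    have hcp := hT.completelyPositive t
    refine ⟨hcp.map_mul_of_eq (hT.map_one t) (hx t).1 y, ?_⟩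
    have h2 : T t (star (star x) * star x) = star (T t (star x)) * T t (star x) := by
      rw [hcp.map_star, star_star, star_star, (hx t).2]
    have h3 := congrArg star (hcp.map_mul_of_eq (hT.map_one t) h2 (star y))
    rwa [← hcp.map_star, star_mul, star_mul, hcp.map_star, hcp.map_star, star_star, star_star,
      star_star, star_star] at h3
  · intro hx t
    rw [(hx t _).1, (hx t _).2, (hT.completelyPositive t).map_star]
    exact ⟨rfl, rfl⟩

/-- `N(T)` as a `*`-subalgebra of `B(H)`. -/
def IsUniformlyContinuousQMS.decoherenceFreeAlgebra : StarSubalgebra ℂ (H →L[ℂ] H) where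
  carrier := decoherenceFree T
  mul_mem' {a b} ha hb := by
    rw [hT.mem_decoherenceFree_iff] at *
    intro t y
    rw [← mul_assoc, (hb t _).1, (ha t _).1, (hb t _).1, mul_assoc, mul_assoc a, (ha t _).2,
      (hb t _).2, mul_assoc]
    exact ⟨rfl, rfl⟩
  add_mem' {a b} ha hb := by
    rw [hT.mem_decoherenceFree_iff] at *
    intro t y
    simp only [mul_add, add_mul, _root_.map_add, (ha t y).1, (ha t y).2, (hb t y).1, (hb t y).2,
      and_self]
  algebraMap_mem' c := by
    rw [hT.mem_decoherenceFree_iff, Algebra.algebraMap_eq_smul_one]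
    intro t y
    simp [hT.map_one]
  star_mem' {a} ha := by
    rw [hT.mem_decoherenceFree_iff] at *
    intro t y
    have hcp := hT.completelyPositive t
    constructor
    · have := congrArg star (ha t (star y)).2
      rwa [← hcp.map_star, star_mul, star_mul, star_star, hcp.map_star, star_star,
        ← hcp.map_star] at this
    · have := congrArg star (ha t (star y)).1
      rwa [← hcp.map_star, star_mul, star_mul, star_star, hcp.map_star, star_star,
        ← hcp.map_star] at this

theorem IsUniformlyContinuousQMS.mem_decoherenceFreeAlgebra {x : H →L[ℂ] H} :
    x ∈ hT.decoherenceFreeAlgebra ↔ x ∈ decoherenceFree T := Iff.rfl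

theorem IsUniformlyContinuousQMS.map_mem_decoherenceFree {x : H →L[ℂ] H}
    (hx : x ∈ decoherenceFree T) (t : ℝ≥0) : T t x ∈ decoherenceFree T := by
  intro s
  have h := hx (s + t)
  have h' := hx t
  rw [hT.map_add, hT.map_add, hT.map_add, h'.1, h'.2] at h
  exact h

/-- `N(T)` is weakly closed, because multiplicativity on the right and on the left passes to weak
limits through normal maps. -/
theorem IsUniformlyContinuousQMS.mem_decoherenceFree_of_tendsto {α : Type*} {X : α → H →L[ℂ] H}
    {l : Filter α} [l.NeBot] {x : H →L[ℂ] H} (h : BoundedWeakTendsto X l x)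
    (hX : ∀ a, X a ∈ decoherenceFree T) : x ∈ decoherenceFree T := by
  rw [hT.mem_decoherenceFree_iff]
  intro t y
  have hn := hT.normal t
  constructor
  · refine ((h.mul_left y).map hn).unique ?_
    simp_rw [fun a => (hT.mem_decoherenceFree_iff.1 (hX a) t y).1]
    exact (h.map hn).mul_left _
  · refine ((h.mul_right y).map hn).unique ?_
    simp_rw [fun a => (hT.mem_decoherenceFree_iff.1 (hX a) t y).2]
    exact (h.map hn).mul_right _

/-- The center of `N(T)` as a `*`-subalgebra of `B(H)`. -/
noncomputable def IsUniformlyContinuousQMS.centerAlgebra : StarSubalgebra ℂ (H →L[ℂ] H) :=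
  hT.decoherenceFreeAlgebra ⊓ StarSubalgebra.centralizer ℂ (decoherenceFree T)

theorem IsUniformlyContinuousQMS.mem_centerAlgebra {x : H →L[ℂ] H} :
    x ∈ hT.centerAlgebra ↔ x ∈ centerOf (decoherenceFree T) := by
  rw [centerAlgebra, StarSubalgebra.mem_inf, StarSubalgebra.mem_centralizer_iff]
  refine and_congr Iff.rfl ⟨fun h y hy => (h y hy).1.symm, fun h y hy => ⟨(h y hy).symm, ?_⟩⟩
  exact (h _ (hT.decoherenceFreeAlgebra.star_mem' hy)).symm

theorem IsUniformlyContinuousQMS.mem_center_of_tendsto {α : Type*} {X : α → H →L[ℂ] H}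
    {l : Filter α} [l.NeBot] {x : H →L[ℂ] H} (h : BoundedWeakTendsto X l x)
    (hX : ∀ a, X a ∈ centerOf (decoherenceFree T)) : x ∈ centerOf (decoherenceFree T) := by
  refine ⟨hT.mem_decoherenceFree_of_tendsto h fun a => (hX a).1, fun y hy => ?_⟩
  refine (h.mul_right y).unique ?_
  simp_rw [fun a => (hX a).2 y hy]
  exact h.mul_left y

theorem IsUniformlyContinuousQMS.isClosed_centerAlgebra :
    IsClosed (hT.centerAlgebra : Set (H →L[ℂ] H)) := by
  rw [centerAlgebra, StarSubalgebra.coe_inf]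
  refine IsClosed.inter ?_ ?_
  · have : (hT.decoherenceFreeAlgebra : Set (H →L[ℂ] H)) =
        ⋂ t, ⋂ y, {x | T t (y * x) = T t y * T t x} ∩ {x | T t (x * y) = T t x * T t y} := by
      ext x
      simp only [SetLike.mem_coe, hT.mem_decoherenceFreeAlgebra, hT.mem_decoherenceFree_iff,
        Set.mem_iInter]
      rfl
    rw [this]
    exact isClosed_iInter fun t => isClosed_iInter fun y =>
      (isClosed_eq (by fun_prop) (by fun_prop)).inter (isClosed_eq (by fun_prop) (by fun_prop))
  · rw [StarSubalgebra.coe_centralizer]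
    exact Set.isClosed_centralizer _

/-- A central unitary `u` is fixed by `T t` once `‖T t - id‖ < 1`: the powers of `T t u * u*` are
`T t (u ^ n) * (u ^ n)*`, which stay close to the identity. -/
theorem IsUniformlyContinuousQMS.map_unitary_of_norm_lt {t : ℝ≥0}
    (ht : ‖T t - ContinuousLinearMap.id ℂ (H →L[ℂ] H)‖ < 1) {u : H →L[ℂ] H}
    (hu : u ∈ unitary (H →L[ℂ] H)) (hc : u ∈ hT.centerAlgebra) : T t u = u := by
  have hus : star u ∈ hT.centerAlgebra := star_mem hc
  have hcomm : Commute (T t u) (star u) :=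
    ((hT.mem_centerAlgebra.1 hus).2 _
      (hT.map_mem_decoherenceFree (hT.mem_centerAlgebra.1 hc).1 t)).symm
  have hpow : ∀ n : ℕ, T t (u ^ n) = T t u ^ n := by
    intro n
    induction n with
    | zero => simp [hT.map_one]
    | succ n ih =>
      rw [pow_succ, (hT.mem_decoherenceFree_iff.1 (hT.mem_centerAlgebra.1 hc).1 t _).1, ih,
        pow_succ]
  have hw : T t u * star u = 1 := by
    refine QMS.eq_one_of_norm_pow_sub_one_le ht fun n => ?_
    have hun : u ^ n ∈ unitary (H →L[ℂ] H) := pow_mem hu n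
    have hle : ∀ v ∈ unitary (H →L[ℂ] H), ‖v‖ ≤ 1 := fun v hv => by
      have h1 := CStarRing.norm_star_mul_self (x := v)
      rw [Unitary.star_mul_self_of_mem hv] at h1
      have h2 : ‖(1 : H →L[ℂ] H)‖ ≤ 1 := norm_id_le
      nlinarith [norm_nonneg v]
    rw [hcomm.mul_pow, ← hpow, ← star_pow, ← Unitary.mul_star_self_of_mem hun, ← sub_mul]
    refine (norm_mul_le _ _).trans ?_
    have h1 : ‖T t (u ^ n) - u ^ n‖ ≤ ‖T t - ContinuousLinearMap.id ℂ (H →L[ℂ] H)‖ * ‖u ^ n‖ :=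
      (T t - ContinuousLinearMap.id ℂ (H →L[ℂ] H)).le_opNorm (u ^ n)
    rw [norm_star]
    have h2 := hle _ hun
    calc _ ≤ ‖T t - ContinuousLinearMap.id ℂ (H →L[ℂ] H)‖ * ‖u ^ n‖ * ‖u ^ n‖ := by gcongr
      _ ≤ ‖T t - ContinuousLinearMap.id ℂ (H →L[ℂ] H)‖ * 1 * 1 := by gcongr
      _ = _ := by ring
  calc T t u = T t u * (star u * u) := by rw [Unitary.star_mul_self_of_mem hu, mul_one]
    _ = u := by rw [← mul_assoc, hw, one_mul]

theorem IsUniformlyContinuousQMS.map_center_of_norm_lt {t : ℝ≥0}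
    (ht : ‖T t - ContinuousLinearMap.id ℂ (H →L[ℂ] H)‖ < 1) {z : H →L[ℂ] H}
    (hz : z ∈ centerOf (decoherenceFree T)) : T t z = z := by
  let _ : CStarAlgebra hT.centerAlgebra :=
    StarSubalgebra.cstarAlgebra _ (h_closed := hT.isClosed_centerAlgebra)
  have h : (⟨z, hT.mem_centerAlgebra.2 hz⟩ : hT.centerAlgebra) ∈
      Submodule.span ℂ (unitary hT.centerAlgebra : Set hT.centerAlgebra) := by
    rw [CStarAlgebra.span_unitary]; trivial
  suffices ∀ y : hT.centerAlgebra, y ∈ Submodule.span ℂ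
      (unitary hT.centerAlgebra : Set hT.centerAlgebra) → T t (y : H →L[ℂ] H) = y from this _ h
  intro y hy
  induction hy using Submodule.span_induction with
  | mem u hu =>
    refine hT.map_unitary_of_norm_lt ht ?_ u.2
    have hu := Unitary.mem_iff.1 hu
    exact Unitary.mem_iff.2 ⟨congrArg Subtype.val hu.1, congrArg Subtype.val hu.2⟩
  | zero => exact _root_.map_zero _
  | add a b _ _ ha hb => rw [AddMemClass.coe_add, _root_.map_add, ha, hb]
  | smul c a _ ha => 
    change T t (c • (a : H →L[ℂ] H)) = c • (a : H →L[ℂ] H)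
    rw [map_smul, ha]

theorem IsUniformlyContinuousQMS.eventually_norm_lt {ε : ℝ} (hε : 0 < ε) :
    ∃ δ : ℝ≥0, 0 < δ ∧ ∀ t ≤ δ, ‖T t - ContinuousLinearMap.id ℂ (H →L[ℂ] H)‖ < ε := by
  have h := hT.uniformlyContinuous.eventually (gt_mem_nhds hε)
  rw [eventually_nhdsWithin_iff, Metric.eventually_nhds_iff] at h
  obtain ⟨δ, hδ, h⟩ := h
  refine ⟨⟨δ / 2, by positivity⟩, by exact_mod_cast half_pos hδ, fun t ht => ?_⟩
  rcases eq_or_ne t 0 with rfl | h0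
  · simpa [hT.map_zero] using hε
  · refine h ?_ (pos_iff_ne_zero.2 h0)
    have ht' : (t : ℝ) ≤ δ / 2 := ht
    rw [NNReal.dist_eq, NNReal.coe_zero, sub_zero, abs_of_nonneg t.coe_nonneg]
    linarith

/-- The semigroup acts trivially on the center of `N(T)`. -/
theorem IsUniformlyContinuousQMS.map_center {z : H →L[ℂ] H}
    (hz : z ∈ centerOf (decoherenceFree T)) (t : ℝ≥0) : T t z = z := by
  obtain ⟨δ, hδ, h⟩ := hT.eventually_norm_lt one_pos
  obtain ⟨n, hn⟩ := exists_nat_gt (t / δ)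
  have key : ∀ k : ℕ, T (k * (t / n)) z = z := by
    intro k
    induction k with
    | zero => simp [hT.map_zero]
    | succ k ih =>
      rw [Nat.cast_succ, add_mul, one_mul, hT.map_add, hT.map_center_of_norm_lt (h _ ?_) hz, ih]
      have hn0 : (0 : ℝ≥0) < n := hn.bot_lt
      rw [div_le_iff₀ hn0, mul_comm]
      exact ((div_lt_iff₀ hδ).1 hn).le
  have hn0 : (n : ℝ≥0) ≠ 0 := (hn.bot_lt).ne'
  simpa [mul_div_cancel₀ _ hn0] using key n

end DecoherenceFree

/-! ### Ergodic means and invariant states -/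

section ErgodicMeans

variable {H : Type*} [NormedAddCommGroup H] [InnerProductSpace ℂ H] [CompleteSpace H]

theorem exists_tendsto_ultrafilter_of_norm_le {α : Type*} (l : Ultrafilter α) {f : α → ℂ} {C : ℝ}
    (h : ∀ a, ‖f a‖ ≤ C) : ∃ z, Tendsto f l (𝓝 z) := by
  have hc := isCompact_closedBall (0 : ℂ) C
  obtain ⟨z, -, hz⟩ := hc.ultrafilter_le_nhds (l.map f)
    (le_principal_iff.2 (mem_map.2 (univ_mem' fun a => mem_closedBall_zero_iff.2 (h a))))
  exact ⟨z, hz⟩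

/-- Bounded families of operators have weak limits along ultrafilters. -/
theorem exists_boundedWeakTendsto_ultrafilter {α : Type*} (l : Ultrafilter α) {X : α → H →L[ℂ] H}
    {C : ℝ} (h : ∀ a, ‖X a‖ ≤ C) : ∃ x, BoundedWeakTendsto X l x := by
  have hb : ∀ u v a, ‖inner ℂ (X a u) v‖ ≤ C * ‖u‖ * ‖v‖ := fun u v a =>
    (norm_inner_le_norm _ _).trans (by gcongr; exact (le_opNorm _ _).trans (by gcongr; exact h a))
  choose g hg using fun u v => exists_tendsto_ultrafilter_of_norm_le l (hb u v)
  have hbd : ∀ u v, ‖g u v‖ ≤ C * ‖u‖ * ‖v‖ := fun u v =>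
    le_of_tendsto (hg u v).norm (Eventually.of_forall (hb u v))
  let B : H →ₗ⋆[ℂ] H →ₗ[ℂ] ℂ := LinearMap.mk₂'ₛₗ (starRingEnd ℂ) (RingHom.id ℂ) g
    (fun u u' v => tendsto_nhds_unique (hg _ _) <| by
      simpa only [map_add, inner_add_left] using (hg u v).add (hg u' v))
    (fun c u v => tendsto_nhds_unique (hg _ _) <| by
      simpa only [map_smul, inner_smul_left, smul_eq_mul] using (hg u v).const_mul _)
    (fun u v v' => tendsto_nhds_unique (hg _ _) <| by
      simpa only [inner_add_right] using (hg u v).add (hg u v'))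
    (fun c u v => tendsto_nhds_unique (hg _ _) <| by
      simpa only [inner_smul_right, smul_eq_mul, RingHom.id_apply] using (hg u v).const_mul c)
  let B' : H →L⋆[ℂ] H →L[ℂ] ℂ := B.mkContinuous₂ C hbd
  refine ⟨InnerProductSpace.continuousLinearMapOfBilin B', ⟨C, h⟩, fun u v => ?_⟩
  have h1 : inner ℂ (InnerProductSpace.continuousLinearMapOfBilin B' v) u = g v u :=
    InnerProductSpace.continuousLinearMapOfBilin_apply B' v u
  rw [← inner_conj_symm, h1]
  have := (Complex.continuous_conj.tendsto _).comp (hg v u)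
  refine this.congr fun a => ?_
  exact inner_conj_symm _ _

variable {T : ℝ≥0 → (H →L[ℂ] H) →L[ℂ] (H →L[ℂ] H)} (hT : IsUniformlyContinuousQMS T)
include hT

theorem IsUniformlyContinuousQMS.norm_map_le (t : ℝ≥0) (x : H →L[ℂ] H) : ‖T t x‖ ≤ ‖x‖ :=
  (hT.completelyPositive t).norm_map_le (hT.map_one t) x

omit hT in
/-- The discretized ergodic mean of `s ↦ T s x` over `[0, n + 1]`: `(n + 1) ^ 2` equidistant
sampling points with step `1 / (n + 1)`. The step tends to `0` and the range to `∞`. -/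
noncomputable def ergodicMean (T : ℝ≥0 → (H →L[ℂ] H) →L[ℂ] (H →L[ℂ] H)) (x : H →L[ℂ] H) (n : ℕ) :
    H →L[ℂ] H :=
  ((((n + 1) ^ 2 : ℕ) : ℂ))⁻¹ • ∑ j ∈ Finset.range ((n + 1) ^ 2), T (j * ((n : ℝ≥0) + 1)⁻¹) x

theorem IsUniformlyContinuousQMS.norm_ergodicMean_le (x : H →L[ℂ] H) (n : ℕ) :
    ‖ergodicMean T x n‖ ≤ ‖x‖ := by
  have h : ‖∑ j ∈ Finset.range ((n + 1) ^ 2), T (j * ((n : ℝ≥0) + 1)⁻¹) x‖ ≤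
      ((n + 1) ^ 2 : ℕ) * ‖x‖ := by
    refine (norm_sum_le_of_le _ fun j _ => hT.norm_map_le _ x).trans ?_
    simp
  rw [ergodicMean, norm_smul, norm_inv, Complex.norm_natCast]
  rw [inv_mul_le_iff₀ (by positivity)]
  exact h

/-- The means are asymptotically invariant: a shift by `k` sampling steps changes at most `2 k`
summands. -/
theorem IsUniformlyContinuousQMS.norm_map_ergodicMean_sub_le (x : H →L[ℂ] H) (n k : ℕ) :
    ‖T (k * ((n : ℝ≥0) + 1)⁻¹) (ergodicMean T x n) - ergodicMean T x n‖ ≤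
      2 * k * ‖x‖ / (n + 1) ^ 2 := by
  set N := (n + 1) ^ 2 with hN
  set f : ℕ → H →L[ℂ] H := fun j => T (j * ((n : ℝ≥0) + 1)⁻¹) x
  have h1 : T (k * ((n : ℝ≥0) + 1)⁻¹) (ergodicMean T x n) - ergodicMean T x n =
      ((N : ℂ))⁻¹ • (∑ j ∈ Finset.range k, f (N + j) - ∑ j ∈ Finset.range k, f j) := by
    have h2 : T (k * ((n : ℝ≥0) + 1)⁻¹) (ergodicMean T x n) =
        ((N : ℂ))⁻¹ • ∑ j ∈ Finset.range N, f (k + j) := by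
      rw [ergodicMean, map_smul, map_sum]
      refine congrArg _ (Finset.sum_congr rfl fun j _ => ?_)
      rw [← hT.map_add, ← add_mul, ← Nat.cast_add]
    rw [h2, ergodicMean, ← smul_sub]
    congr 1
    have h3 := Finset.sum_range_add f k N
    have h4 := Finset.sum_range_add f N k
    rw [add_comm k N, h4] at h3
    rw [sub_eq_sub_iff_add_eq_add, add_comm, ← h3, add_comm]
  have hb : ∀ g : ℕ → ℕ, ‖∑ j ∈ Finset.range k, f (g j)‖ ≤ k * ‖x‖ := fun g => by
    refine (norm_sum_le_of_le _ fun j _ => hT.norm_map_le _ x).trans ?_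
    simp
  rw [h1, norm_smul, norm_inv, Complex.norm_natCast, inv_mul_eq_div, hN]
  push_cast
  gcongr
  refine (norm_sub_le _ _).trans ((add_le_add (hb _) (hb fun j => j)).trans ?_)
  linarith

theorem IsUniformlyContinuousQMS.tendsto_map_ergodicMean_sub (x : H →L[ℂ] H) (t : ℝ≥0) :
    Tendsto (fun n => T t (ergodicMean T x n) - ergodicMean T x n) atTop (𝓝 0) := by
  rw [Metric.tendsto_atTop]
  intro ε hε
  obtain ⟨δ, hδ, hsmall⟩ := hT.eventually_norm_lt (ε := ε / (2 * (‖x‖ + 1))) (by positivity)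
  -- Split `t = k h + r` with step `h = 1 / (n + 1)` and `r ≤ h`. For `n ≥ m` the first bound makes
  -- `r ≤ δ`, so that `T r` is close to the identity, and the second controls the shift by `k h`.
  obtain ⟨m, hm⟩ := exists_nat_gt (max ((δ : ℝ)⁻¹) (2 * (t * (2 * ‖x‖) / ε)))
  refine ⟨m, fun n hn => ?_⟩
  have hn' : (m : ℝ) ≤ n := by exact_mod_cast hn
  set k := ⌊t * (n + 1)⌋₊ with hk
  set r := t - k * ((n : ℝ≥0) + 1)⁻¹ with hr
  have hn1 : (0 : ℝ≥0) < n + 1 := by positivity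
  have hkt : k * ((n : ℝ≥0) + 1)⁻¹ ≤ t := by
    rw [← div_eq_mul_inv, div_le_iff₀ hn1]
    exact Nat.floor_le (by positivity)
  have hrt : r + k * ((n : ℝ≥0) + 1)⁻¹ = t := tsub_add_cancel_of_le hkt
  have hrδ : r ≤ δ := by
    have h1 : t * (n + 1) < k + 1 := Nat.lt_floor_add_one _
    have h2 : r ≤ ((n : ℝ≥0) + 1)⁻¹ := by
      rw [hr, tsub_le_iff_right, ← one_add_mul, ← div_eq_mul_inv, le_div_iff₀ hn1, add_comm 1]
      exact h1.le
    refine h2.trans (inv_le_of_inv_le₀ hδ ?_)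
    have h3 := (le_max_left _ _).trans_lt hm
    have : ((δ⁻¹ : ℝ≥0) : ℝ) ≤ ((n + 1 : ℝ≥0) : ℝ) := by push_cast; linarith
    exact_mod_cast this
  set E := ergodicMean T x n
  have hdec : T t E - E = (T (k * ((n : ℝ≥0) + 1)⁻¹) (T r E - E)) +
      (T (k * ((n : ℝ≥0) + 1)⁻¹) E - E) := by
    rw [map_sub, ← hT.map_add, add_comm _ r, hrt]; abel
  have hE := hT.norm_ergodicMean_le x n
  rw [dist_zero_right, hdec]
  have e1 : ‖T (k * ((n : ℝ≥0) + 1)⁻¹) (T r E - E)‖ ≤ ε / (2 * (‖x‖ + 1)) * ‖x‖ := by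
    refine (hT.norm_map_le _ _).trans ?_
    refine ((T r - ContinuousLinearMap.id ℂ (H →L[ℂ] H)).le_opNorm E).trans ?_
    have := hsmall r hrδ
    gcongr
  have e2 := hT.norm_map_ergodicMean_sub_le x n k
  have e3 : 2 * k * ‖x‖ / ((n : ℝ) + 1) ^ 2 < ε / 2 := by
    have h1 : (k : ℝ) ≤ t * (n + 1) := by
      have : (k : ℝ≥0) ≤ t * (n + 1) := Nat.floor_le (by positivity)
      exact_mod_cast this
    have h3 : 2 * (t * (2 * ‖x‖) / ε) < n + 1 := by
      have := (le_max_right _ _).trans_lt hm; linarith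
    have h4 : t * (2 * ‖x‖) < (n + 1) * (ε / 2) := by
      have : 2 * (t * (2 * ‖x‖) / ε) = t * (2 * ‖x‖) / (ε / 2) := by field_simp
      rw [this, div_lt_iff₀ (by positivity)] at h3
      exact h3
    rw [div_lt_iff₀ (by positivity)]
    calc 2 * k * ‖x‖ ≤ 2 * (t * (n + 1)) * ‖x‖ := by gcongr
      _ = t * (2 * ‖x‖) * (n + 1) := by ring
      _ < (n + 1) * (ε / 2) * (n + 1) := by gcongr
      _ = _ := by ring
  have e4 : ε / (2 * (‖x‖ + 1)) * ‖x‖ ≤ ε / 2 := by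
    rw [div_mul_eq_mul_div, div_le_div_iff₀ (by positivity) two_pos]
    nlinarith [norm_nonneg x]
  refine (norm_add_le _ _).trans_lt ?_
  linarith

theorem IsUniformlyContinuousQMS.trace_ergodicMean {σ : H →L[ℂ] H} (hσ : IsNormalPositive σ)
    (hinv : IsInvariant T σ) (x : H →L[ℂ] H) (n : ℕ) :
    trace (σ * ergodicMean T x n) = trace (σ * x) := by
  rw [ergodicMean, hσ.trace_mul_smul, hσ.trace_mul_sum, Finset.sum_congr rfl fun j _ => hinv _ x]
  rw [Finset.sum_const, Finset.card_range, nsmul_eq_mul, inv_mul_cancel_left₀]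
  exact Nat.cast_ne_zero.2 (by positivity)

/-- In the presence of a faithful normal invariant state, fixed points lie in `N(T)`. -/
theorem IsUniformlyContinuousQMS.mem_decoherenceFree_of_fixed {ρ : H →L[ℂ] H}
    (hρ : IsNormalPositive ρ) (hinv : IsInvariant T ρ) (hf : IsFaithful ρ) {x : H →L[ℂ] H}
    (hx : ∀ t, T t x = x) : x ∈ decoherenceFree T := by
  have key : ∀ (y : H →L[ℂ] H), (∀ t, T t y = y) → ∀ t, T t (star y * y) = star y * y := by
    intro y hy t
    have h1 := (hT.completelyPositive t).star_mul_le (hT.map_one t) y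
    rw [hy, ← sub_nonneg] at h1
    refine sub_eq_zero.1 (hf _ h1 ?_)
    rw [hρ.trace_mul_sub, hinv, sub_self]
  intro t
  have hx' : ∀ t, T t (star x) = star x := fun t => by
    rw [(hT.completelyPositive t).map_star, hx]
  refine ⟨by rw [hx, key x hx], ?_⟩
  have := key _ hx' t
  rw [star_star] at this
  rw [hx, this]

/-- The central elements of `N(T)` commute with every normal invariant state `σ`: a weak limit
point `E` of the ergodic means of `x` is a fixed point, hence lies in `N(T)`, so that
`tr (σ z x) = tr (σ z E) = tr (σ E z) = tr (σ x z)`. -/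
theorem IsUniformlyContinuousQMS.commute_of_mem_center {ρ : H →L[ℂ] H} (hρ : IsNormalPositive ρ)
    (hinv : IsInvariant T ρ) (hf : IsFaithful ρ) {σ : H →L[ℂ] H} (hσ : IsNormalPositive σ)
    (hσinv : IsInvariant T σ) {z : H →L[ℂ] H} (hz : z ∈ centerOf (decoherenceFree T)) :
    σ * z = z * σ := by
  have hmul := fun t y => hT.mem_decoherenceFree_iff.1 hz.1 t y
  have hfix := hT.map_center hz
  have key : ∀ x, trace (σ * (z * x)) = trace (σ * (x * z)) := by
    intro x
    set l : Ultrafilter ℕ := Ultrafilter.of atTop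
    have hl : (l : Filter ℕ) ≤ atTop := Ultrafilter.of_le _
    obtain ⟨E, hE⟩ := exists_boundedWeakTendsto_ultrafilter l (hT.norm_ergodicMean_le x)
    have hEfix : ∀ t, T t E = E := fun t => by
      refine (hE.map (hT.normal t)).unique ⟨⟨‖T t‖ * ‖x‖, fun n => ?_⟩, fun u v => ?_⟩
      · exact (le_opNorm _ _).trans (by gcongr; exact hT.norm_ergodicMean_le x n)
      · have h1 := (hT.tendsto_map_ergodicMean_sub x t).mono_left hl
        have h2 : Tendsto (fun n => inner ℂ u
            ((T t (ergodicMean T x n) - ergodicMean T x n) v)) l (𝓝 (inner ℂ u (0 : H))) :=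
          tendsto_const_nhds.inner
            (((ContinuousLinearMap.apply ℂ H v).continuous.tendsto 0).comp h1)
        have h3 := h2.add (hE.tendsto u v)
        rw [inner_zero_right, zero_add] at h3
        refine h3.congr fun n => ?_
        rw [sub_apply, inner_sub_right, sub_add_cancel]
    have hEmem := hT.mem_decoherenceFree_of_fixed hρ hinv hf hEfix
    have hl1 : trace (σ * (z * E)) = trace (σ * (z * x)) := by
      refine tendsto_nhds_unique ((hE.mul_left z).trace hσ) ?_
      -- `T t (z x) = z (T t x)`, as `z` is a fixed point in the multiplicative domain
      have : ∀ n, z * ergodicMean T x n = ergodicMean T (z * x) n := fun n => by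
        rw [ergodicMean, ergodicMean, mul_smul_comm, Finset.mul_sum]
        simp_rw [fun t y => (hmul t y).2, hfix]
      simp_rw [this, hT.trace_ergodicMean hσ hσinv]
      exact tendsto_const_nhds
    have hl2 : trace (σ * (E * z)) = trace (σ * (x * z)) := by
      refine tendsto_nhds_unique ((hE.mul_right z).trace hσ) ?_
      have : ∀ n, ergodicMean T x n * z = ergodicMean T (x * z) n := fun n => by
        rw [ergodicMean, ergodicMean, smul_mul_assoc, Finset.sum_mul]
        simp_rw [fun t y => (hmul t y).1, hfix]
      simp_rw [this, hT.trace_ergodicMean hσ hσinv]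
      exact tendsto_const_nhds
    rw [← hl1, ← hl2, hz.2 E hEmem]
  -- evaluation on the rank one operators
  ext u
  refine ext_inner_left ℂ fun v => ?_
  have h := key (InnerProductSpace.rankOne ℂ u v)
  rw [show z * InnerProductSpace.rankOne ℂ u v = InnerProductSpace.rankOne ℂ (z u) v from
      InnerProductSpace.comp_rankOne _ _ _,
    show InnerProductSpace.rankOne ℂ u v * z = InnerProductSpace.rankOne ℂ u (adjoint z v) from
      InnerProductSpace.rankOne_comp _ _ _, hσ.trace_mul_rankOne, hσ.trace_mul_rankOne,
    adjoint_inner_left] at h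
  exact h

end ErgodicMeans

/-! ### Projections and spectral subspaces -/

section HilbertSpaceOperators

variable {H : Type*} [NormedAddCommGroup H] [InnerProductSpace ℂ H] [CompleteSpace H]

/-- An increasing net of projections converges strongly to a projection. -/
theorem exists_tendsto_of_monotone_isStarProjection {ι : Type*} [Preorder ι] {P : ι → H →L[ℂ] H}
    (hP : ∀ i, IsStarProjection (P i)) (hmono : ∀ i j, i ≤ j → P j * P i = P i) :
    ∃ e : H →L[ℂ] H, IsStarProjection e ∧ (∀ i, e * P i = P i) ∧
      BoundedWeakTendsto P atTop e ∧ ∀ v, Tendsto (fun i => P i v) atTop (𝓝 (e v)) := by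
  choose V hV hPV using fun i => isStarProjection_iff_eq_starProjection.1 (hP i)
  have hmem : ∀ i v, v ∈ V i ↔ P i v = v := fun i v => by
    rw [hPV, Submodule.starProjection_eq_self_iff]
  have hVmono : Monotone V := fun i j hij v hv => by
    rw [hmem] at *
    conv_rhs => rw [← hv, ← hmono i j hij]
    rw [mul_def, comp_apply, hv]
  have htend : ∀ v, Tendsto (fun i => P i v) atTop
      (𝓝 ((⨆ i, V i).topologicalClosure.starProjection v)) := fun v => by
    simp_rw [hPV]
    exact Submodule.starProjection_tendsto_closure_iSup V hVmono v
  refine ⟨(⨆ i, V i).topologicalClosure.starProjection, isStarProjection_starProjection,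
    fun i => ?_, .of_tendsto ⟨1, fun i => (hP i).norm_le⟩ htend, htend⟩
  ext v
  refine Submodule.starProjection_eq_self_iff.2 ?_
  refine (Submodule.le_topologicalClosure _) (le_iSup V i ((hmem _ _).2 ?_))
  exact congr($((hP i).isIdempotentElem.eq) v)

/-- The projection onto the kernel of `y` is a weak limit of elements of the `*`-algebra generated
by `y`: by the mean ergodic theorem it is the limit of the averages of the powers of the
contraction `1 - y* y / ‖y* y‖`, whose fixed points are the vectors in the kernel. -/
theorem exists_tendsto_kernelProjection (S : StarSubalgebra ℂ (H →L[ℂ] H)) {y : H →L[ℂ] H}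
    (hy : y ∈ S) : ∃ (X : ℕ → H →L[ℂ] H) (q : H →L[ℂ] H), (∀ n, X n ∈ S) ∧
      BoundedWeakTendsto X atTop q ∧ IsStarProjection q ∧ ∀ v, q v = v ↔ y v = 0 := by
  set a := star y * y with ha
  have ha0 : 0 ≤ a := star_mul_self_nonneg y
  set f : H →L[ℂ] H := 1 - ((‖a‖⁻¹ : ℝ) : ℂ) • a with hf
  have hfS : f ∈ S := sub_mem (one_mem S) (S.smul_mem (mul_mem (star_mem hy) hy) _)
  have hone : ‖(1 : H →L[ℂ] H)‖ ≤ 1 := norm_id_le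
  have hfn : ‖f‖ ≤ 1 := by
    have hb0 : (0 : H →L[ℂ] H) ≤ (‖a‖⁻¹ : ℝ) • a := smul_nonneg (by positivity) ha0
    have hb1 : (‖a‖⁻¹ : ℝ) • a ≤ 1 := by
      rw [← CStarAlgebra.norm_le_one_iff_of_nonneg _ hb0, norm_smul, norm_inv, norm_norm]
      exact inv_mul_le_one
    have hfe : f = 1 - (‖a‖⁻¹ : ℝ) • a := by
      rw [hf, RCLike.real_smul_eq_coe_smul (K := ℂ)]; rfl
    rw [hfe]
    refine (CStarAlgebra.norm_le_norm_of_nonneg_of_le (sub_nonneg.2 hb1) ?_).trans hone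
    exact sub_le_self _ hb0
  set F := f.eqLocus (1 : H →L[ℂ] H) with hF
  have hFmem : ∀ v, v ∈ F ↔ y v = 0 := by
    intro v
    have h1 : v ∈ F ↔ ((‖a‖⁻¹ : ℝ) : ℂ) • a v = 0 := by
      change v - ((‖a‖⁻¹ : ℝ) : ℂ) • a v = v ↔ _
      rw [sub_eq_self]
    rw [h1]
    constructor
    · intro h
      have h2 : a v = 0 := by
        rcases smul_eq_zero.1 h with h | h
        · have : a = 0 := by simpa using h
          rw [this]; rfl
        · exact h
      have h3 : inner ℂ (a v) v = inner ℂ (y v) (y v) := adjoint_inner_left y v (y v)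
      rw [h2, inner_zero_left] at h3
      exact inner_self_eq_zero.1 h3.symm
    · intro h
      have : a v = star y (y v) := rfl
      rw [this, h, _root_.map_zero, smul_zero]
  have hFc : CompleteSpace F :=
    (isClosed_eq f.continuous (1 : H →L[ℂ] H).continuous).completeSpace_coe
  refine ⟨fun n => (n : ℂ)⁻¹ • ∑ k ∈ Finset.range n, f ^ k, F.starProjection,
    fun n => S.smul_mem (sum_mem fun k _ => pow_mem hfS k) _,
    .of_tendsto ⟨1, fun n => ?_⟩ fun v => ?_,
    isStarProjection_starProjection, fun v => ?_⟩
  · rw [norm_smul, norm_inv, Complex.norm_natCast]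
    have hpow : ∀ k : ℕ, ‖f ^ k‖ ≤ 1 := fun k => by
      induction k with
      | zero => simpa using hone
      | succ k ih =>
        rw [pow_succ]
        exact (norm_mul_le _ _).trans (mul_le_one₀ ih (norm_nonneg _) hfn)
    have : ‖∑ k ∈ Finset.range n, f ^ k‖ ≤ n :=
      (norm_sum_le _ _).trans
        ((Finset.sum_le_card_nsmul _ _ 1 fun k _ => hpow k).trans (by simp))
    exact (mul_le_mul_of_nonneg_left this (by positivity)).trans inv_mul_le_one
  · refine (f.tendsto_birkhoffAverage_orthogonalProjection hfn v).congr fun n => ?_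
    rw [birkhoffAverage, birkhoffSum, smul_apply, sum_apply]
    simp
  · rw [Submodule.starProjection_eq_self_iff, hFmem]

/-- The spectral part of a positive trace class operator above `ε > 0` is finite-dimensional: on it
`⟨v, σ v⟩ ≥ ε ‖v‖²`, so that every orthonormal basis contributes at least `ε` per vector to the
trace. -/
theorem IsNormalPositive.finiteDimensional_range_posPart {σ : H →L[ℂ] H} (hσ : IsNormalPositive σ)
    {ε : ℝ} (hε : 0 < ε) :
    FiniteDimensional ℂ ((σ - (ε : ℂ) • 1)⁺ : H →L[ℂ] H).range := by
  set b : H →L[ℂ] H := σ - (ε : ℂ) • 1 with hb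
  have hbs : IsSelfAdjoint b := by
    refine hσ.1.isSelfAdjoint.sub ?_
    rw [IsSelfAdjoint, star_smul, star_one, RCLike.star_def, Complex.conj_ofReal]
  obtain ⟨A, hA, hAσ⟩ := hσ.exists_isHilbertSchmidt
  have hA2 : ∀ v, inner ℂ (σ v) v = ((‖A v‖ ^ 2 : ℝ) : ℂ) := fun v => by
    have h1 : inner ℂ ((A† ∘L A) v) v = inner ℂ (A v) (A v) := adjoint_inner_left A v (A v)
    rw [← hAσ, h1, inner_self_eq_norm_sq_to_K]; norm_cast
  have hlow : ∀ v ∈ (b⁺).range, ε * ‖v‖ ^ 2 ≤ ‖A v‖ ^ 2 := by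
    rintro _ ⟨w, rfl⟩
    set v := b⁺ w with hv
    change ε * ‖v‖ ^ 2 ≤ ‖A v‖ ^ 2
    have h1 : b v = b⁺ v := by
      have h2 : b * b⁺ = b⁺ * b⁺ := by
        have h5 := congrArg (· * b⁺) (CFC.posPart_sub_negPart b hbs)
        rw [← h5]
        rw [sub_mul, CFC.negPart_mul_posPart, sub_zero]
      exact congr($h2 w)
    have h3 : 0 ≤ (inner ℂ (b v) v).re := by
      rw [h1]
      exact ((nonneg_iff_isPositive _).1 (CFC.posPart_nonneg b)).re_inner_nonneg_left v
    have h4 : inner ℂ (b v) v = ((‖A v‖ ^ 2 - ε * ‖v‖ ^ 2 : ℝ) : ℂ) := by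
      have : b v = σ v - (ε : ℂ) • v := rfl
      rw [this, inner_sub_left, hA2, inner_smul_left, Complex.conj_ofReal,
        inner_self_eq_norm_sq_to_K]
      push_cast
      rfl
    rw [h4, Complex.ofReal_re] at h3
    linarith
  set K := (b⁺).range.topologicalClosure with hK
  have hlowK : ∀ v ∈ K, ε * ‖v‖ ^ 2 ≤ ‖A v‖ ^ 2 := by
    intro v hv
    have hcl : IsClosed {v : H | ε * ‖v‖ ^ 2 ≤ ‖A v‖ ^ 2} :=
      isClosed_le (by fun_prop) (by fun_prop)
    exact closure_minimal hlow hcl hv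
  have : CompleteSpace K := (Submodule.isClosed_topologicalClosure _).completeSpace_coe
  have hs : Summable fun e : basisIndex K => ε := by
    refine Summable.of_nonneg_of_le (fun _ => hε.le) (fun e => ?_) (hA.comp K.subtypeL)
    have h1 := hlowK (basis K e) (basis K e).2
    have h2 : ‖((basis K e : K) : H)‖ = 1 := (basis K).orthonormal.norm_eq_one e
    rw [h2, one_pow, mul_one] at h1
    exact h1
  have hfin : Finite (basisIndex K) := by
    by_contra h
    rw [not_finite_iff_infinite] at h
    exact hε.ne' ((summable_const_iff _).1 hs)
  have hspan := (basis K).dense_span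
  have hfd : FiniteDimensional ℂ (Submodule.span ℂ (Set.range (basis K))) :=
    FiniteDimensional.span_of_finite ℂ (Set.finite_range _)
  rw [(Submodule.closed_of_finiteDimensional _).submodule_topologicalClosure_eq] at hspan
  have : FiniteDimensional ℂ K := by
    rw [hspan] at hfd
    exact Module.finite_def.2 (Module.Finite.iff_fg.1 hfd)
  exact Submodule.finiteDimensional_of_le (Submodule.le_topologicalClosure _)

/-- A projection that commutes with `σ ≥ 0` and kills all the spectral parts above `ε > 0`
kills `σ`. -/
theorem mul_eq_zero_of_forall_mul_posPart {σ p : H →L[ℂ] H} (hσ : 0 ≤ σ) (hp : IsStarProjection p)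
    (hcomm : σ * p = p * σ) (h : ∀ ε : ℝ, 0 < ε → p * (σ - (ε : ℂ) • 1)⁺ = 0) : σ * p = 0 := by
  have hpos : 0 ≤ p * σ * p := by
    have := star_left_conjugate_nonneg hσ p
    rwa [hp.isSelfAdjoint.star_eq] at this
  have hpσ : p * σ * p = σ * p := by
    rw [← hcomm, mul_assoc, hp.isIdempotentElem.eq]
  have hle : ∀ ε : ℝ, 0 < ε → p * σ * p ≤ (ε : ℂ) • p := by
    intro ε hε
    set b : H →L[ℂ] H := σ - (ε : ℂ) • 1 with hb
    have hbs : IsSelfAdjoint b := by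
      refine hσ.isSelfAdjoint.sub ?_
      rw [IsSelfAdjoint, star_smul, star_one, RCLike.star_def, Complex.conj_ofReal]
    have h1 : p * b * p = - (p * b⁻ * p) := by
      conv_lhs => rw [← CFC.posPart_sub_negPart b hbs]
      rw [mul_sub, h ε hε, zero_sub, neg_mul]
    have h2 : 0 ≤ p * b⁻ * p := by
      have := star_left_conjugate_nonneg (CFC.negPart_nonneg b) p
      rwa [hp.isSelfAdjoint.star_eq] at this
    have h3 : p * b * p = p * σ * p - (ε : ℂ) • p := by
      rw [hb, mul_sub, sub_mul, mul_smul_comm, mul_one, smul_mul_assoc, hp.isIdempotentElem.eq]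
    rw [← sub_nonneg, ← neg_sub, ← h3, h1, neg_neg]
    exact h2
  rw [← hpσ, ← norm_le_zero_iff]
  refine le_of_forall_pos_le_add fun ε hε => ?_
  have h1 := CStarAlgebra.norm_le_norm_of_nonneg_of_le hpos (hle ε hε)
  rw [norm_smul, Complex.norm_real, Real.norm_of_nonneg hε.le] at h1
  nlinarith [hp.norm_le]

theorem commute_posPart_sub {σ z : H →L[ℂ] H} (ε : ℝ) (h : σ * z = z * σ) :
    (σ - (ε : ℂ) • 1)⁺ * z = z * (σ - (ε : ℂ) • 1)⁺ := by
  have : Commute (σ - (ε : ℂ) • 1) z := by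
    refine Commute.sub_left h ?_
    exact (Commute.one_left z).smul_left _
  rw [CFC.posPart_def]
  exact this.cfcₙ_real _

theorem IsFaithful.eq_zero_of_mul_eq_zero {σ p : H →L[ℂ] H} (hf : IsFaithful σ) (hp : 0 ≤ p)
    (h : σ * p = 0) : p = 0 :=
  hf p hp (by rw [h, trace]; simp)

theorem exists_mul_posPart_ne_zero {σ p : H →L[ℂ] H} (hσ : 0 ≤ σ) (hf : IsFaithful σ)
    (hp : IsStarProjection p) (hcomm : σ * p = p * σ) (hp0 : p ≠ 0) :
    ∃ ε : ℝ, 0 < ε ∧ p * (σ - (ε : ℂ) • 1)⁺ ≠ 0 := by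
  by_contra! h
  exact hp0 (hf.eq_zero_of_mul_eq_zero hp.nonneg (mul_eq_zero_of_forall_mul_posPart hσ hp hcomm h))

end HilbertSpaceOperators

/-! ### Atomicity of the center -/

section Atomicity

variable {H : Type*} [NormedAddCommGroup H] [InnerProductSpace ℂ H] [CompleteSpace H]

/-- `p` is a projection in the center of `N(T)`. -/
def IsCentralProjection (T : ℝ≥0 → (H →L[ℂ] H) →L[ℂ] (H →L[ℂ] H)) (p : H →L[ℂ] H) : Prop :=
  IsStarProjection p ∧ p ∈ centerOf (decoherenceFree T)

variable {T : ℝ≥0 → (H →L[ℂ] H) →L[ℂ] (H →L[ℂ] H)}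

theorem IsCentralProjection.commute {p q : H →L[ℂ] H} (hp : IsCentralProjection T p)
    (hq : IsCentralProjection T q) : p * q = q * p := hp.2.2 q hq.2.1

theorem IsUniformlyContinuousQMS.isCentralProjection_mul (hT : IsUniformlyContinuousQMS T)
    {p q : H →L[ℂ] H} (hp : IsCentralProjection T p) (hq : IsCentralProjection T q) :
    IsCentralProjection T (p * q) :=
  ⟨hp.1.mul hq.1 (hp.commute hq), hT.mem_centerAlgebra.1
    (mul_mem (hT.mem_centerAlgebra.2 hp.2) (hT.mem_centerAlgebra.2 hq.2))⟩

theorem IsUniformlyContinuousQMS.isCentralProjection_one_sub (hT : IsUniformlyContinuousQMS T)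
    {p : H →L[ℂ] H} (hp : IsCentralProjection T p) : IsCentralProjection T (1 - p) :=
  ⟨hp.1.one_sub, hT.mem_centerAlgebra.1
    (sub_mem (one_mem _) (hT.mem_centerAlgebra.2 hp.2))⟩

/-- Below every nonzero central projection `p` there is a nonzero vector that each central
projection fixes or kills. It is found in a finite-dimensional spectral subspace `W` of `ρ`, which
all central projections leave invariant: take `q ≤ p` with `q W` nonzero of minimal dimension. -/
theorem exists_pure_vector {ρ : H →L[ℂ] H} (hρ : IsNormalPositive ρ) (hf : IsFaithful ρ)
    (hT : IsUniformlyContinuousQMS T)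
    (hcomm : ∀ z ∈ centerOf (decoherenceFree T), ρ * z = z * ρ) {p : H →L[ℂ] H}
    (hp : IsCentralProjection T p) (hp0 : p ≠ 0) :
    ∃ v, v ≠ 0 ∧ p v = v ∧ ∀ q, IsCentralProjection T q → q v = v ∨ q v = 0 := by
  obtain ⟨ε, hε, hne⟩ := exists_mul_posPart_ne_zero hρ.1 hf hp.1 (hcomm p hp.2) hp0
  set B : H →L[ℂ] H := (ρ - (ε : ℂ) • 1)⁺ with hB
  have hBc : ∀ q, IsCentralProjection T q → q * B = B * q := fun q hq =>
    (commute_posPart_sub ε (hcomm q hq.2)).symm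
  set W : Submodule ℂ H := B.range with hW
  have hfd : FiniteDimensional ℂ W := hρ.finiteDimensional_range_posPart hε
  have hinv : ∀ q, IsCentralProjection T q → ∀ w ∈ W, q w ∈ W := by
    rintro q hq _ ⟨w, rfl⟩
    exact ⟨q w, congr($((hBc q hq).symm) w)⟩
  let V : (H →L[ℂ] H) → Submodule ℂ H := fun q => W.map (q : H →ₗ[ℂ] H)
  have hVfd : ∀ q, FiniteDimensional ℂ (V q) := fun q => inferInstance
  let S : Set (H →L[ℂ] H) := {q | IsCentralProjection T q ∧ p * q = q ∧ V q ≠ ⊥}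
  have hpS : p ∈ S := by
    refine ⟨hp, hp.1.isIdempotentElem.eq, fun h => hne ?_⟩
    ext w
    have : p (B w) ∈ V p := ⟨B w, ⟨w, rfl⟩, rfl⟩
    rw [h, Submodule.mem_bot] at this
    exact this
  obtain ⟨q, ⟨hq, hpq, hqV⟩, hmin⟩ :=
    exists_minimalFor_of_wellFoundedLT (· ∈ S) (fun q => Module.finrank ℂ (V q)) ⟨p, hpS⟩
  obtain ⟨v, hv, hv0⟩ := (Submodule.ne_bot_iff _).1 hqV
  have hqv : ∀ v ∈ V q, q v = v := by
    rintro _ ⟨w, -, rfl⟩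
    exact congr($(hq.1.isIdempotentElem.eq) w)
  refine ⟨v, hv0, ?_, fun r hr => ?_⟩
  · rw [← hqv v hv]
    exact congr($hpq v)
  · have hrq := hT.isCentralProjection_mul hr hq
    have hle : V (r * q) ≤ V q := by
      rintro _ ⟨w, hw, rfl⟩
      refine ⟨r w, hinv r hr w hw, ?_⟩
      exact congr($((hr.commute hq).symm) w)
    have hvr : r v ∈ V (r * q) := by
      obtain ⟨w, hw, rfl⟩ := hv
      exact ⟨w, hw, rfl⟩
    by_cases h : V (r * q) = ⊥
    · rw [h, Submodule.mem_bot] at hvr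
      exact Or.inr hvr
    · left
      have hS : r * q ∈ S := by
        refine ⟨hrq, ?_, h⟩
        rw [hr.commute hq, ← mul_assoc, hpq]
      have hrank : Module.finrank ℂ (V q) ≤ Module.finrank ℂ (V (r * q)) :=
        hmin hS (Submodule.finrank_mono hle)
      have heq := Submodule.eq_of_le_of_finrank_le hle hrank
      rw [← heq] at hv
      obtain ⟨w, -, rfl⟩ := hv
      change r (r (q w)) = r (q w)
      exact congr($(hr.1.isIdempotentElem.eq) (q w))

/-- Each pure vector `v` has a smallest central projection that fixes it, and this projection is
minimal in the center: it is the complement of the largest central projection that kills `v`. -/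
theorem IsUniformlyContinuousQMS.exists_minimal_of_pure (hT : IsUniformlyContinuousQMS T)
    {p : H →L[ℂ] H} (hp : IsCentralProjection T p) {v : H} (hv : v ≠ 0) (hpv : p v = v)
    (hpure : ∀ q, IsCentralProjection T q → q v = v ∨ q v = 0) :
    ∃ c, IsMinimalCentralProjection (decoherenceFree T) c ∧ p * c = c := by
  let S := {q : H →L[ℂ] H // IsCentralProjection T q ∧ q v = 0}
  have hdir : IsDirectedOrder S := ⟨fun q r => by
    have hqr := q.2.1.commute r.2.1
    have h1 : IsStarProjection (q.1 + r.1 - q.1 * r.1) :=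
      q.2.1.1.add_sub_mul_of_commute hqr r.2.1.1
    have hq := q.2.1.1.isIdempotentElem.eq
    have hr := r.2.1.1.isIdempotentElem.eq
    refine ⟨⟨q.1 + r.1 - q.1 * r.1, ⟨h1, ?_⟩, ?_⟩, ?_, ?_⟩
    · have hq := hT.mem_centerAlgebra.2 q.2.1.2
      have hr := hT.mem_centerAlgebra.2 r.2.1.2
      exact hT.mem_centerAlgebra.1 (sub_mem (add_mem hq hr) (mul_mem hq hr))
    · change q.1 v + r.1 v - q.1 (r.1 v) = 0
      rw [r.2.2, q.2.2, _root_.map_zero, add_zero, sub_zero]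
    · refine (q.2.1.1.le_iff_mul_eq_left h1).2 ?_
      rw [mul_sub, mul_add, ← mul_assoc, hq, add_sub_cancel_right]
    · refine (r.2.1.1.le_iff_mul_eq_left h1).2 ?_
      rw [mul_sub, mul_add, hqr, ← mul_assoc, hr, add_sub_cancel_left]⟩
  have hzero : IsCentralProjection T (0 : H →L[ℂ] H) :=
    ⟨.zero _, hT.mem_centerAlgebra.1 (zero_mem _)⟩
  have hne : Nonempty S := ⟨⟨0, hzero, rfl⟩⟩
  obtain ⟨f, hf, hfS, hweak, htend⟩ := exists_tendsto_of_monotone_isStarProjection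
    (P := fun q : S => q.1) (fun q => q.2.1.1)
    (fun q r hqr => (q.2.1.1.le_iff_mul_eq_right r.2.1.1).1 hqr)
  have hfc : IsCentralProjection T f := ⟨hf, hT.mem_center_of_tendsto hweak fun q => q.2.1.2⟩
  have hfv : f v = 0 := by
    refine tendsto_nhds_unique (htend v) ?_
    simp_rw [fun q : S => q.2.2]
    exact tendsto_const_nhds
  have hmax : ∀ q, IsCentralProjection T q → q v = 0 → (1 - f) * q = 0 := fun q hq hqv => by
    rw [sub_mul, one_mul, hfS ⟨q, hq, hqv⟩, sub_self]
  have hcv : (1 - f) v = v := by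
    change v - f v = v
    rw [hfv, sub_zero]
  have hc := hT.isCentralProjection_one_sub hfc
  refine ⟨1 - f, ⟨hc.1, hc.2, ?_, fun q hq hqs hle => ?_⟩, ?_⟩
  · intro h0
    rw [h0] at hcv
    exact hv hcv.symm
  · have hq' : IsCentralProjection T q := ⟨hqs, hq⟩
    have h1 : (1 - f) * q = q := (hqs.le_iff_mul_eq_right hc.1).1 hle
    rcases hpure q hq' with h | h
    · right
      have h2 := hmax _ (hT.isCentralProjection_mul hc (hT.isCentralProjection_one_sub hq')) (by
        change (1 - f) (v - q v) = 0
        rw [h, sub_self, _root_.map_zero])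
      rw [← mul_assoc, hc.1.isIdempotentElem.eq, mul_sub, mul_one, h1, sub_eq_zero] at h2
      exact h2.symm
    · left
      rw [← h1, hmax q hq' h]
  · have h1 := hmax _ (hT.isCentralProjection_one_sub hp) (by
      change v - p v = 0
      rw [hpv, sub_self])
    rw [mul_sub, mul_one, sub_eq_zero, hc.commute hp] at h1
    exact h1.symm

theorem IsMinimalCentralProjection.isCentralProjection {p : H →L[ℂ] H}
    (hp : IsMinimalCentralProjection (decoherenceFree T) p) : IsCentralProjection T p :=
  ⟨hp.isStarProjection, hp.mem_center⟩

/-- A minimal central projection is either below or orthogonal to any central projection. -/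
theorem IsUniformlyContinuousQMS.mul_eq_zero_or_eq (hT : IsUniformlyContinuousQMS T)
    {p q : H →L[ℂ] H} (hp : IsMinimalCentralProjection (decoherenceFree T) p)
    (hq : IsCentralProjection T q) : p * q = 0 ∨ p * q = p := by
  have h := hT.isCentralProjection_mul hp.isCentralProjection hq
  refine hp.minimal _ h.2 h.1 ((h.1.le_iff_mul_eq_right hp.isStarProjection).2 ?_)
  rw [← mul_assoc, hp.isStarProjection.isIdempotentElem.eq]

theorem IsUniformlyContinuousQMS.minimal_orthogonal (hT : IsUniformlyContinuousQMS T)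
    {p q : H →L[ℂ] H} (hp : IsMinimalCentralProjection (decoherenceFree T) p)
    (hq : IsMinimalCentralProjection (decoherenceFree T) q) (hpq : p ≠ q) : p * q = 0 := by
  refine (hT.mul_eq_zero_or_eq hp hq.isCentralProjection).resolve_right fun h => ?_
  rcases hT.mul_eq_zero_or_eq hq hp.isCentralProjection with h' | h'
  · rw [hq.isCentralProjection.commute hp.isCentralProjection, h] at h'
    exact hp.ne_zero h'
  · rw [hq.isCentralProjection.commute hp.isCentralProjection, h] at h'
    exact hpq h'

theorem IsUniformlyContinuousQMS.isCentralProjection_sum (hT : IsUniformlyContinuousQMS T)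
    {ι : Type*} {p : ι → H →L[ℂ] H} (hp : ∀ i, IsCentralProjection T (p i))
    (horth : ∀ i j, i ≠ j → p i * p j = 0) (s : Finset ι) :
    IsCentralProjection T (∑ i ∈ s, p i) ∧
      ∀ t ⊆ s, (∑ i ∈ s, p i) * ∑ i ∈ t, p i = ∑ i ∈ t, p i := by
  classical
  have hmul : ∀ t ⊆ s, (∑ i ∈ s, p i) * ∑ i ∈ t, p i = ∑ i ∈ t, p i := by
    intro t ht
    rw [Finset.mul_sum]
    refine Finset.sum_congr rfl fun j hj => ?_
    rw [Finset.sum_mul, Finset.sum_eq_single_of_mem j (ht hj) fun i _ hij => horth i j hij]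
    exact (hp j).1.isIdempotentElem.eq
  refine ⟨⟨⟨hmul s subset_rfl, ?_⟩, ?_⟩, hmul⟩
  · exact isSelfAdjoint_sum s fun i _ => (hp i).1.isSelfAdjoint
  · exact hT.mem_centerAlgebra.1 (sum_mem fun i _ => hT.mem_centerAlgebra.2 (hp i).2)

/-- The center of `N(T)` is atomic: its minimal projections sum to the identity. -/
theorem IsUniformlyContinuousQMS.hasSum_minimal (hT : IsUniformlyContinuousQMS T)
    {ρ : H →L[ℂ] H} (hρ : IsNormalPositive ρ) (hf : IsFaithful ρ)
    (hcomm : ∀ z ∈ centerOf (decoherenceFree T), ρ * z = z * ρ) (v : H) :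
    HasSum (fun c : {c // IsMinimalCentralProjection (decoherenceFree T) c} => c.1 v) v := by
  set ι := {c // IsMinimalCentralProjection (decoherenceFree T) c}
  have horth : ∀ i j : ι, i ≠ j → i.1 * j.1 = 0 := fun i j hij =>
    hT.minimal_orthogonal i.2 j.2 fun h => hij (Subtype.ext h)
  have hsum := hT.isCentralProjection_sum (p := fun i : ι => i.1)
    (fun i => i.2.isCentralProjection) horth
  obtain ⟨e, he, heP, hweak, htend⟩ := exists_tendsto_of_monotone_isStarProjection
    (P := fun s : Finset ι => ∑ i ∈ s, i.1) (fun s => (hsum s).1.1)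
    (fun s t hst => (hsum t).2 s hst)
  have hec : IsCentralProjection T e :=
    ⟨he, hT.mem_center_of_tendsto hweak fun s => (hsum s).1.2⟩
  -- a minimal projection below the complement of the sum `e` would also be below `e`
  have he1 : 1 - e = 0 := by
    by_contra h0
    have hc := hT.isCentralProjection_one_sub hec
    obtain ⟨w, hw0, hw, hpure⟩ := exists_pure_vector hρ hf hT hcomm hc h0
    obtain ⟨c, hcmin, hle⟩ := hT.exists_minimal_of_pure hc hw0 hw hpure
    have h1 := heP {⟨c, hcmin⟩}
    rw [Finset.sum_singleton] at h1
    rw [sub_mul, one_mul, h1, sub_self] at hle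
    exact hcmin.ne_zero hle.symm
  have h2 := htend v
  rw [← sub_eq_zero.1 he1] at h2
  simpa [HasSum, sum_apply] using h2

/-- An element of the center of `N(T)` below a minimal central projection `p` is a multiple of
`p`: it has an eigenvector in the finite-dimensional spectral subspace of `ρ` under `p`, and the
projection onto the corresponding eigenspace is central, hence dominates `p`. -/
theorem IsUniformlyContinuousQMS.exists_eq_smul_of_minimal (hT : IsUniformlyContinuousQMS T)
    {ρ : H →L[ℂ] H} (hρ : IsNormalPositive ρ) (hf : IsFaithful ρ)
    (hcomm : ∀ z ∈ centerOf (decoherenceFree T), ρ * z = z * ρ) {p z : H →L[ℂ] H}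
    (hp : IsMinimalCentralProjection (decoherenceFree T) p)
    (hz : z ∈ centerOf (decoherenceFree T)) (hzp : z * p = z) : ∃ c : ℂ, z = c • p := by
  have hps := hp.isStarProjection
  obtain ⟨ε, hε, hne⟩ := exists_mul_posPart_ne_zero hρ.1 hf hps (hcomm p hp.mem_center) hp.ne_zero
  set B : H →L[ℂ] H := (ρ - (ε : ℂ) • 1)⁺ with hB
  set W : Submodule ℂ H := B.range with hW
  have hfd : FiniteDimensional ℂ W := hρ.finiteDimensional_range_posPart hε
  set V : Submodule ℂ H := W.map (p : H →ₗ[ℂ] H) with hV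
  have hVfd : FiniteDimensional ℂ V := inferInstance
  have hVne : V ≠ ⊥ := fun h => hne <| by
    ext w
    have : p (B w) ∈ V := ⟨B w, ⟨w, rfl⟩, rfl⟩
    rw [h, Submodule.mem_bot] at this
    exact this
  have hnt : Nontrivial V := Submodule.nontrivial_iff_ne_bot.2 hVne
  have hzV : ∀ v ∈ V, (z : H →ₗ[ℂ] H) v ∈ V := by
    rintro _ ⟨_, ⟨w, rfl⟩, rfl⟩
    refine ⟨z (B w), ⟨z w, ?_⟩, ?_⟩
    · exact congr($(commute_posPart_sub ε (hcomm z hz)) w)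
    · exact congr($(hp.mem_center.2 z hz.1) (B w))
  obtain ⟨c, hc⟩ := Module.End.exists_eigenvalue ((z : H →ₗ[ℂ] H).restrict hzV)
  obtain ⟨⟨v, hvV⟩, hv⟩ := hc.exists_hasEigenvector
  have hv0 : v ≠ 0 := fun h => hv.2 (Subtype.ext h)
  have hzv : z v = c • v := congrArg Subtype.val (Module.End.mem_eigenspace_iff.1 hv.1)
  have hpv : p v = v := by
    obtain ⟨w, -, rfl⟩ := hvV
    exact congr($(hps.isIdempotentElem.eq) w)
  refine ⟨c, ?_⟩
  have hy : z - c • p ∈ hT.centerAlgebra := sub_mem (hT.mem_centerAlgebra.2 hz)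
    (hT.centerAlgebra.smul_mem (hT.mem_centerAlgebra.2 hp.mem_center) c)
  obtain ⟨X, q, hX, hXq, hq, hqker⟩ := exists_tendsto_kernelProjection hT.centerAlgebra hy
  have hqc : IsCentralProjection T q :=
    ⟨hq, hT.mem_center_of_tendsto hXq fun n => hT.mem_centerAlgebra.1 (hX n)⟩
  have hqv : q v = v := by
    rw [hqker]
    change z v - c • p v = 0
    rw [hpv, hzv, sub_self]
  have hpq : p * q = p := by
    refine (hT.mul_eq_zero_or_eq hp hqc).resolve_left fun h => hv0 ?_
    have : p (q v) = 0 := congr($h v)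
    rwa [hqv, hpv] at this
  have hyp : (z - c • p) * p = 0 := by
    ext w
    refine (hqker (p w)).1 ?_
    have : q * p = p := by rw [hqc.commute hp.isCentralProjection, hpq]
    exact congr($this w)
  rwa [sub_mul, hzp, smul_mul_assoc, hps.isIdempotentElem.eq, sub_eq_zero] at hyp

end Atomicity

/-! ### Decomposition into factors, and corners -/

section Existence

variable {H : Type*} [NormedAddCommGroup H] [InnerProductSpace ℂ H] [CompleteSpace H]

/-- In a separable Hilbert space a family of mutually orthogonal nonzero projections is countable:
the open sets `{v | ‖v - p i v‖ < ‖p i v‖}` are disjoint. -/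
theorem countable_of_orthogonal [TopologicalSpace.SeparableSpace H] {ι : Type*} {p : ι → H →L[ℂ] H}
    (hp : ∀ i, IsStarProjection (p i)) (h0 : ∀ i, p i ≠ 0)
    (horth : ∀ i j, i ≠ j → p i * p j = 0) : Countable ι := by
  have hlt : ∀ i j v, i ≠ j → ‖v - p i v‖ < ‖p i v‖ → ‖p j v‖ < ‖p i v‖ := by
    intro i j v hij h
    refine lt_of_le_of_lt ?_ h
    have h1 : p j (v - p i v) = p j v := by
      rw [map_sub, show p j (p i v) = 0 from congr($(horth j i hij.symm) v), sub_zero]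
    rw [← h1]
    exact (le_of_opNorm_le _ (hp j).norm_le _).trans (one_mul _).le
  refine Pairwise.countable_of_isOpen_disjoint (s := fun i => {v : H | ‖v - p i v‖ < ‖p i v‖})
    (fun i j hij => Set.disjoint_left.2 fun v hi hj =>
      lt_asymm (hlt i j v hij hi) (hlt j i v hij.symm hj))
    (fun i => isOpen_lt (by fun_prop) (by fun_prop)) fun i => ?_
  obtain ⟨v, hv⟩ : ∃ v, p i v ≠ 0 := by
    by_contra! h
    exact h0 i (ContinuousLinearMap.ext h)
  refine ⟨p i v, ?_⟩
  change ‖p i v - p i (p i v)‖ < ‖p i (p i v)‖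
  rw [show p i (p i v) = p i v from congr($((hp i).isIdempotentElem.eq) v), sub_self, norm_zero]
  exact norm_pos_iff.2 hv

/-- The finite partial sums of a resolution of the identity compress every `x` to operators that
converge to `x`. -/
theorem tendsto_sum_mul_sum {ι : Type*} {p : ι → H →L[ℂ] H} (hp : ∀ s : Finset ι,
    IsStarProjection (∑ i ∈ s, p i)) (hsum : ∀ v, HasSum (fun i => p i v) v) (x : H →L[ℂ] H) :
    BoundedWeakTendsto (fun s : Finset ι => (∑ i ∈ s, p i) * x * ∑ i ∈ s, p i) atTop x := by
  have htend : ∀ v, Tendsto (fun s : Finset ι => (∑ i ∈ s, p i) v) atTop (𝓝 v) := fun v => by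
    simpa [HasSum, sum_apply] using hsum v
  refine ⟨⟨1 * ‖x‖ * 1, fun s => (norm_mul_le _ _).trans ?_⟩, fun u v => ?_⟩
  · have := (hp s).norm_le
    gcongr
    exact (norm_mul_le _ _).trans (by gcongr)
  · refine ((htend u).inner ((x.continuous.tendsto v).comp (htend v))).congr fun s => ?_
    exact ((hp s).isSelfAdjoint.isSymmetric u _)

variable {T : ℝ≥0 → (H →L[ℂ] H) →L[ℂ] (H →L[ℂ] H)}

theorem IsUniformlyContinuousQMS.mem_iff_of_hasSum (hT : IsUniformlyContinuousQMS T) {ι : Type*}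
    {p : ι → H →L[ℂ] H} (hp : ∀ i, IsCentralProjection T (p i))
    (horth : ∀ i j, i ≠ j → p i * p j = 0) (hsum : ∀ v, HasSum (fun i => p i v) v)
    (x : H →L[ℂ] H) : x ∈ decoherenceFree T ↔
      (∀ i j, i ≠ j → p i * x * p j = 0) ∧
        ∀ i, p i * x * p i ∈ blockOf (decoherenceFree T) (p i) := by
  constructor
  · intro hx
    refine ⟨fun i j hij => ?_, fun i => ⟨x, hx, rfl⟩⟩
    rw [(hp i).2.2 x hx, mul_assoc, horth i j hij, mul_zero]
  · rintro ⟨hoff, hdiag⟩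
    refine hT.mem_decoherenceFree_of_tendsto (tendsto_sum_mul_sum
      (fun s => (hT.isCentralProjection_sum hp horth s).1.1) hsum x) fun s => ?_
    have : (∑ i ∈ s, p i) * x * ∑ i ∈ s, p i = ∑ i ∈ s, p i * x * p i := by
      rw [Finset.sum_mul, Finset.sum_mul]
      refine Finset.sum_congr rfl fun i hi => ?_
      rw [Finset.mul_sum, Finset.sum_eq_single_of_mem i hi fun j _ hij => hoff i j hij.symm]
    rw [this, ← hT.mem_decoherenceFreeAlgebra]
    refine sum_mem fun i _ => ?_
    obtain ⟨y, hy, hyx⟩ := hdiag i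
    rw [← hyx]
    exact mul_mem (mul_mem (hp i).2.1 hy) (hp i).2.1

/-- The block under a minimal central projection `p` is a factor: its center lies in the center of
`N(T)`, where the elements below `p` are multiples of `p`. -/
theorem IsUniformlyContinuousQMS.centerOf_blockOf (hT : IsUniformlyContinuousQMS T)
    {ρ : H →L[ℂ] H} (hρ : IsNormalPositive ρ) (hf : IsFaithful ρ)
    (hcomm : ∀ z ∈ centerOf (decoherenceFree T), ρ * z = z * ρ) {p : H →L[ℂ] H}
    (hp : IsMinimalCentralProjection (decoherenceFree T) p) :
    centerOf (blockOf (decoherenceFree T) p) = Set.range fun c : ℂ => c • p := by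
  have hps := hp.isStarProjection.isIdempotentElem.eq
  have hpN : p ∈ hT.decoherenceFreeAlgebra := hp.mem_center.1
  ext z
  constructor
  · rintro ⟨⟨w, hw, rfl⟩, hz⟩
    set z := p * w * p with hzdef
    have hzN : z ∈ hT.decoherenceFreeAlgebra := mul_mem (mul_mem hpN hw) hpN
    have hzp : z * p = z := by rw [hzdef, mul_assoc, hps]
    have hpz : p * z = z := by rw [hp.mem_center.2 z hzN, hzp]
    have hzc : z ∈ centerOf (decoherenceFree T) := by
      refine ⟨hzN, fun y hy => ?_⟩
      have hpy := hp.mem_center.2 y hy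
      have h1 := hz (p * y * p) ⟨y, hy, rfl⟩
      calc z * y = z * (p * y * p) := by
            rw [hpy, mul_assoc y, hps, ← hpy, ← mul_assoc, hzp]
        _ = p * y * p * z := h1
        _ = y * z := by rw [mul_assoc _ p z, hpz, hpy, mul_assoc, hpz]
    obtain ⟨c, hc⟩ := hT.exists_eq_smul_of_minimal hρ hf hcomm hp hzc hzp
    exact ⟨c, hc.symm⟩
  · rintro ⟨c, rfl⟩
    refine ⟨⟨c • p, hT.decoherenceFreeAlgebra.smul_mem hpN c, ?_⟩, ?_⟩
    · change p * (c • p) * p = c • p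
      rw [mul_smul_comm, smul_mul_assoc, hps, hps]
    · rintro _ ⟨y, -, rfl⟩
      change c • p * (p * y * p) = p * y * p * c • p
      rw [smul_mul_assoc, mul_smul_comm, ← mul_assoc, ← mul_assoc, hps, mul_assoc (p * y), hps]

theorem IsUniformlyContinuousQMS.exists_isFactorDecomposition
    [TopologicalSpace.SeparableSpace H] (hT : IsUniformlyContinuousQMS T)
    {ρ : H →L[ℂ] H} (hρ : IsNormalPositive ρ) (hf : IsFaithful ρ)
    (hcomm : ∀ z ∈ centerOf (decoherenceFree T), ρ * z = z * ρ) :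
    ∃ (ι : Type) (_ : Countable ι) (p : ι → H →L[ℂ] H),
      IsFactorDecomposition (decoherenceFree T) p := by
  set κ := {c // IsMinimalCentralProjection (decoherenceFree T) c}
  have horth : ∀ i j : κ, i ≠ j → i.1 * j.1 = 0 := fun i j hij =>
    hT.minimal_orthogonal i.2 j.2 fun h => hij (Subtype.ext h)
  have hcount : Countable κ := countable_of_orthogonal (fun i => i.2.isStarProjection)
    (fun i => i.2.ne_zero) horth
  -- the index type has to live in the lowest universe
  let e := (equivShrink.{0} κ).symm
  have horth' : ∀ i j, i ≠ j → (e i).1 * (e j).1 = 0 := fun i j hij =>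
    horth _ _ fun h => hij (e.injective h)
  have hsum : ∀ v, HasSum (fun i => (e i).1 v) v := fun v =>
    e.hasSum_iff.2 (hT.hasSum_minimal hρ hf hcomm v)
  exact ⟨Shrink.{0} κ, e.injective.countable, fun i => (e i).1,
    { minimal := fun i => (e i).2
      orthogonal := horth'
      hasSum := hsum
      mem_iff := hT.mem_iff_of_hasSum (fun i => (e i).2.isCentralProjection) horth' hsum
      factor := fun i => hT.centerOf_blockOf hρ hf hcomm (e i).2 }⟩

end Existence

section Reduction

variable {H : Type*} [NormedAddCommGroup H] [InnerProductSpace ℂ H] [CompleteSpace H]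

theorem starProjection_rangeSpace {p : H →L[ℂ] H} (hp : IsStarProjection p) :
    (rangeSpace p).starProjection = p := by
  refine IsStarProjection.ext isStarProjection_starProjection hp ?_
  ext v
  rw [Submodule.range_starProjection, LinearMap.mem_ker]
  constructor
  · intro h
    exact ⟨v, (sub_eq_zero.1 h).symm⟩
  · rintro ⟨w, rfl⟩
    change p w - p (p w) = 0
    rw [show p (p w) = p w from congr($(hp.isIdempotentElem.eq) w), sub_self]

theorem corner_eq (p x : H →L[ℂ] H) :
    corner p x = (rangeSpace p).subtypeL† ∘L x ∘L (rangeSpace p).subtypeL := by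
  rw [Submodule.adjoint_subtypeL]
  rfl

theorem inflate_eq (p : H →L[ℂ] H) (y : rangeSpace p →L[ℂ] rangeSpace p) :
    inflate p y = (rangeSpace p).subtypeL ∘L y ∘L (rangeSpace p).subtypeL† := by
  rw [Submodule.adjoint_subtypeL]
  rfl

theorem inflate_corner {p : H →L[ℂ] H} (hp : IsStarProjection p) (x : H →L[ℂ] H) :
    inflate p (corner p x) = p * x * p := by
  conv_rhs => rw [← starProjection_rangeSpace hp]
  rfl

theorem corner_inflate (p : H →L[ℂ] H) (y : rangeSpace p →L[ℂ] rangeSpace p) :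
    corner p (inflate p y) = y := by
  ext v
  have h : ∀ w : rangeSpace p, (rangeSpace p).orthogonalProjectionOnto w = w :=
    Submodule.orthogonalProjectionOnto_mem_subspace_eq_self
  change (((rangeSpace p).orthogonalProjectionOnto
    ((y ((rangeSpace p).orthogonalProjectionOnto (v : H)) : rangeSpace p) : H) :
      rangeSpace p) : H) = _
  rw [h, h]

theorem mul_inflate_mul {p : H →L[ℂ] H} (hp : IsStarProjection p)
    (y : rangeSpace p →L[ℂ] rangeSpace p) : p * inflate p y * p = inflate p y := by
  rw [← inflate_corner hp, corner_inflate]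

theorem inflate_one {p : H →L[ℂ] H} (hp : IsStarProjection p) : inflate p 1 = p := by
  conv_rhs => rw [← starProjection_rangeSpace hp]
  rfl

theorem inflate_nonneg {p : H →L[ℂ] H} {y : rangeSpace p →L[ℂ] rangeSpace p}
    (hy : 0 ≤ y) : 0 ≤ inflate p y := by
  rw [inflate_eq, nonneg_iff_isPositive]
  exact ((nonneg_iff_isPositive _).1 hy).conj_adjoint _

theorem IsNormalPositive.corner {σ : H →L[ℂ] H} (hσ : IsNormalPositive σ) (p : H →L[ℂ] H) :
    IsNormalPositive (corner p σ) := by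
  rw [corner_eq]
  exact hσ.conj _

theorem IsNormalPositive.trace_corner_mul {σ : H →L[ℂ] H} (hσ : IsNormalPositive σ)
    (p : H →L[ℂ] H) (y : rangeSpace p →L[ℂ] rangeSpace p) :
    trace (QMS.corner p σ * y) = trace (σ * inflate p y) := by
  rw [corner_eq, inflate_eq, hσ.trace_conj_mul]

theorem IsNormalPositive.trace_compression {σ : H →L[ℂ] H} (hσ : IsNormalPositive σ)
    {p : H →L[ℂ] H} (hp : IsStarProjection p) : trace (p * σ * p) = trace (σ * p) := by
  have h := hσ.trace_conj_mul p 1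
  have hs : p† = p := hp.isSelfAdjoint
  rw [hs, mul_one] at h
  rw [mul_assoc]
  refine h.trans (congrArg (fun x => trace (σ * x)) ?_)
  exact hp.isIdempotentElem.eq

theorem IsNormalPositive.smul {σ : H →L[ℂ] H} (hσ : IsNormalPositive σ) {c : ℝ} (hc : 0 ≤ c) :
    IsNormalPositive ((c : ℂ) • σ) := by
  have h := hσ.conj (((Real.sqrt c : ℝ) : ℂ) • (1 : H →L[ℂ] H))
  have hs : (((Real.sqrt c : ℝ) : ℂ) • (1 : H →L[ℂ] H))† = ((Real.sqrt c : ℝ) : ℂ) • 1 := by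
    change star _ = _
    rw [star_smul, star_one, RCLike.star_def, Complex.conj_ofReal]
  convert h using 1
  change _ = (((Real.sqrt c : ℝ) : ℂ) • (1 : H →L[ℂ] H))† * (σ * (((Real.sqrt c : ℝ) : ℂ) • 1))
  rw [hs, mul_smul_comm, mul_one, smul_mul_assoc, one_mul, smul_smul, ← Complex.ofReal_mul,
    Real.mul_self_sqrt hc]

theorem trace_smul (c : ℂ) (x : H →L[ℂ] H) : trace (c • x) = c * trace x := by
  rw [trace, trace, ← tsum_mul_left]
  refine tsum_congr fun e => ?_
  rw [smul_apply, inner_smul_right]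

/-- A density that commutes with a resolution of the identity is the sum of its blocks in trace
norm: with `Q` the complement of a partial sum of the `p i`, the remainder is the positive operator
`Q σ Q`, whose trace norm is `tr (σ Q)`. -/
theorem tendsto_traceNorm_sub_sum {ι : Type*} {p : ι → H →L[ℂ] H} (hp : ∀ s : Finset ι,
    IsStarProjection (∑ i ∈ s, p i)) (hsum : ∀ v, HasSum (fun i => p i v) v) {σ : H →L[ℂ] H}
    (hσ : IsNormalPositive σ) (hcomm : ∀ i, σ * p i = p i * σ)
    (hidem : ∀ i, p i * p i = p i) :
    Tendsto (fun s : Finset ι => traceNorm (σ - ∑ i ∈ s, p i * σ * p i)) atTop (𝓝 0) := by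
  have key : ∀ s : Finset ι, traceNorm (σ - ∑ i ∈ s, p i * σ * p i) =
      ENNReal.ofReal (trace (σ * (1 - ∑ i ∈ s, p i))).re := by
    intro s
    set Q := 1 - ∑ i ∈ s, p i with hQ
    have hQs : IsStarProjection Q := (hp s).one_sub
    have h1 : ∑ i ∈ s, p i * σ * p i = σ * ∑ i ∈ s, p i := by
      rw [Finset.mul_sum]
      exact Finset.sum_congr rfl fun i _ => by rw [← hcomm, mul_assoc, hidem]
    have h2 : Q * σ = σ * Q := by
      rw [hQ, sub_mul, mul_sub, one_mul, mul_one, Finset.mul_sum, Finset.sum_mul]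
      simp_rw [hcomm]
    have h3 : σ - ∑ i ∈ s, p i * σ * p i = Q * σ * Q := by
      rw [h2, mul_assoc, hQs.isIdempotentElem.eq, h1, hQ, mul_sub, mul_one]
    have h4 : IsNormalPositive (Q * σ * Q) := by
      have := hσ.conj Q
      have hs : Q† = Q := hQs.isSelfAdjoint
      rwa [hs] at this
    rw [h3, h4.traceNorm_eq, hσ.trace_compression hQs]
  simp_rw [key]
  have hw : BoundedWeakTendsto (fun s : Finset ι => 1 - ∑ i ∈ s, p i) atTop (0 : H →L[ℂ] H) := by
    refine .of_tendsto ⟨1, fun s => (hp s).one_sub.norm_le⟩ fun v => ?_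
    have h : Tendsto (fun s : Finset ι => (∑ i ∈ s, p i) v) atTop (𝓝 v) := by
      simpa [HasSum, sum_apply] using hsum v
    simpa using (tendsto_const_nhds (x := v)).sub h
  have h := hw.trace hσ
  have h0 : trace (σ * 0) = 0 := by simpa using hσ.trace_mul_smul 0 0
  rw [h0] at h
  have h' := ENNReal.tendsto_ofReal ((Complex.continuous_re.tendsto _).comp h)
  simpa using h'

end Reduction

/-! ### Restriction of the semigroup to a corner -/

section Restriction

variable {H : Type*} [NormedAddCommGroup H] [InnerProductSpace ℂ H] [CompleteSpace H]
  {T : ℝ≥0 → (H →L[ℂ] H) →L[ℂ] (H →L[ℂ] H)}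

/-- The semigroup leaves `p B(H) p` invariant, since `T t (p x p) = p (T t x) p`. -/
theorem IsUniformlyContinuousQMS.map_inflate (hT : IsUniformlyContinuousQMS T) {p : H →L[ℂ] H}
    (hp : IsCentralProjection T p) (t : ℝ≥0) (y : rangeSpace p →L[ℂ] rangeSpace p) :
    T t (inflate p y) = inflate p (restrict T p t y) := by
  change _ = inflate p (corner p (T t (inflate p y)))
  have hmul := hT.mem_decoherenceFree_iff.1 hp.2.1 t
  rw [inflate_corner hp.1]
  conv_lhs => rw [← mul_inflate_mul hp.1 y]
  rw [(hmul _).1, (hmul _).2, hT.map_center hp.2]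

theorem IsUniformlyContinuousQMS.isInvariant_corner (hT : IsUniformlyContinuousQMS T)
    {p : H →L[ℂ] H} (hp : IsCentralProjection T p) {σ : H →L[ℂ] H} (hσ : IsNormalPositive σ)
    (hinv : IsInvariant T σ) : IsInvariant (restrict T p) (corner p σ) := fun t y => by
  rw [hσ.trace_corner_mul, ← hT.map_inflate hp, hinv, ← hσ.trace_corner_mul]

/-- The normalized restriction of a faithful normal state to a corner is a faithful normal
state. -/
theorem IsNormalPositive.normalized_corner {σ p : H →L[ℂ] H} (hσ : IsNormalPositive σ)
    (hf : IsFaithful σ) (hp : IsStarProjection p) (hp0 : p ≠ 0) :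
    trace (p * σ * p) ≠ 0 ∧
      IsNormalState ((trace (p * σ * p))⁻¹ • QMS.corner p σ) ∧
      IsFaithful ((trace (p * σ * p))⁻¹ • QMS.corner p σ) := by
  have htr := hσ.trace_compression hp
  have hc0 : trace (p * σ * p) ≠ 0 := fun h => hp0 (hf p hp.nonneg (htr ▸ h))
  have hcorner : trace (QMS.corner p σ) = trace (p * σ * p) := by
    have := hσ.trace_corner_mul p 1
    rwa [mul_one, inflate_one hp, ← htr] at this
  have hnn := (hσ.corner p).trace_nonneg
  rw [hcorner] at hnn
  refine ⟨hc0, ⟨?_, ?_⟩, fun y hy h => ?_⟩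
  · obtain ⟨hre, him⟩ := Complex.le_def.1 hnn
    have hreal : trace (p * σ * p) = ((trace (p * σ * p)).re : ℂ) :=
      Complex.ext rfl (by simpa using him.symm)
    rw [hreal, ← Complex.ofReal_inv]
    exact (hσ.corner p).smul (inv_nonneg.2 hre)
  · rw [trace_smul, hcorner, inv_mul_cancel₀ hc0]
  · rw [smul_mul_assoc, trace_smul, hσ.trace_corner_mul] at h
    have h1 := hf _ (inflate_nonneg hy) ((mul_eq_zero.1 h).resolve_left (inv_ne_zero hc0))
    rw [← corner_inflate p y, h1, map_zero]

end Restriction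

end QMS

theorem mainTheorem10 {H : Type*} [NormedAddCommGroup H] [InnerProductSpace ℂ H]
    [CompleteSpace H] [TopologicalSpace.SeparableSpace H]
    (T : ℝ≥0 → (H →L[ℂ] H) →L[ℂ] (H →L[ℂ] H)) (hT : QMS.IsUniformlyContinuousQMS T)
    (hfaithful : ∃ ρ : H →L[ℂ] H,
      QMS.IsNormalState ρ ∧ QMS.IsInvariant T ρ ∧ QMS.IsFaithful ρ) :
    (∃ (ι : Type) (_ : Countable ι) (p : ι → H →L[ℂ] H),
      QMS.IsFactorDecomposition (QMS.decoherenceFree T) p) ∧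
    ∀ (ι : Type*) (p : ι → H →L[ℂ] H),
      QMS.IsFactorDecomposition (QMS.decoherenceFree T) p →
      (∀ i t y, T t (QMS.inflate (p i) y) =
        QMS.inflate (p i) (QMS.restrict T (p i) t y)) ∧
      ∀ σ : H →L[ℂ] H, QMS.IsNormalState σ → QMS.IsInvariant T σ →
        (∀ i j, i ≠ j → p i * σ * p j = 0) ∧
        Tendsto (fun s : Finset ι => QMS.traceNorm (σ - ∑ i ∈ s, p i * σ * p i)) atTop (𝓝 0) ∧
        (∀ i, QMS.IsNormalPositive (QMS.corner (p i) σ) ∧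
          QMS.IsInvariant (QMS.restrict T (p i)) (QMS.corner (p i) σ)) ∧
        (QMS.IsFaithful σ → ∀ i,
          QMS.trace (p i * σ * p i) ≠ 0 ∧
          QMS.IsNormalState ((QMS.trace (p i * σ * p i))⁻¹ • QMS.corner (p i) σ) ∧
          QMS.IsFaithful ((QMS.trace (p i * σ * p i))⁻¹ • QMS.corner (p i) σ)) := by
  obtain ⟨ρ, ⟨hρ, -⟩, hρinv, hρf⟩ := hfaithful
  refine ⟨hT.exists_isFactorDecomposition hρ hρf fun z hz =>
    hT.commute_of_mem_center hρ hρinv hρf hρ hρinv hz, fun ι p hp => ?_⟩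
  have hpc : ∀ i, QMS.IsCentralProjection T (p i) := fun i => (hp.minimal i).isCentralProjection
  refine ⟨fun i t y => hT.map_inflate (hpc i) t y, fun σ hσ hinv => ?_⟩
  have hcomm : ∀ i, σ * p i = p i * σ := fun i =>
    hT.commute_of_mem_center hρ hρinv hρf hσ.1 hinv (hpc i).2
  refine ⟨fun i j hij => ?_, ?_, fun i => ⟨hσ.1.corner _, ?_⟩, fun hf i => ?_⟩
  · rw [← hcomm, mul_assoc, hp.orthogonal i j hij, mul_zero]
  · exact QMS.tendsto_traceNorm_sub_sum
      (fun s => (hT.isCentralProjection_sum hpc hp.orthogonal s).1.1) hp.hasSum hσ.1 hcomm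
      fun i => (hpc i).1.isIdempotentElem.eq
  · exact hT.isInvariant_corner (hpc i) hσ.1 hinv
  · exact hσ.1.normalized_corner hf (hpc i).1 (hp.minimal i).ne_zero
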